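/- Let $M$ be a $\mathrm{II}_1$ factor with separable predual and faithful normal tracial state $\tau$, acting on $L^2(M)=L^2(M,\tau)$ by left multiplication, and let $A\subset M$ be a masa (maximal abelian self-adjoint subalgebra), with $\tau$-preserving normal conditional expectation $\mathbb E_A\colon M\to A$. Let $X$ be a compact metrizable space with $C(X)$ embedded as a unital, weak-operator dense $C^*$-subalgebra of $A$, and let $\lambda$ be the Borel probability measure on $X$ with $\int_X f\,d\lambda=\tau(f)$ for $f\in C(X)$, so that $A\cong L^\infty(X,\lambda)$. Write $L^2(M)\cong\int^\oplus_{X\times X}\mathcal H_{t,s}\,d\eta(t,s)$, where $\eta$ is a finite Borel measure and the $\mathcal H_{t,s}$ are nonzero, so that $\zeta\mapsto a\zeta b$ becomes multiplication by $a(t)b(s)$ for $a,b\in C(X)$. The measure class of $\eta|_{\Delta(X)^c}$, where $\Delta(X)$ is the diagonal of $X\times X$, is called the left--right measure of $A$. Suppose that the left--right measure of $A$ is the class of the product measure $\lambda\otimes\lambda$. Let $x,y\in M$ satisfy $\mathbb E_A(x)=0=\mathbb E_A(y)$. If $(u_n)$ is a bounded sequence in $A$ converging to $0$ in the weak operator topology,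 then the functions $\mathbb E_A(xu_ny^*)\in A\cong L^\infty(X,\lambda)$ converge to $0$ $\lambda$-almost everywhere. -/

import Mathlib

open MeasureTheory Filter Topology
open scoped ENNReal InnerProductSpace ComplexOrder

/-- `M` is a II₁ factor in standard form, with trace vector `Ω`: the vector state
`τ x = ⟪Ω, x Ω⟫` is a faithful (automatically normal) tracial state on the infinite-dimensional
factor `M`, and `Ω` is cyclic. Thus `x ↦ x Ω` identifies the completion `L²(M, τ)` of `M` with `H`,
and `M` acts on it by left multiplication. -/
structure IsIIOneStandardForm {H : Type*} [NormedAddCommGroup H] [InnerProductSpace ℂ H]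
    [CompleteSpace H] (M : VonNeumannAlgebra H) (Ω : H) : Prop where
  norm_eq_one : ‖Ω‖ = 1
  trace_comm : ∀ x ∈ M, ∀ y ∈ M, ⟪Ω, (x * y) Ω⟫_ℂ = ⟪Ω, (y * x) Ω⟫_ℂ
  faithful : ∀ x ∈ M, ⟪Ω, (star x * x) Ω⟫_ℂ = 0 → x = 0
  cyclic : Dense {v : H | ∃ x ∈ M, x Ω = v}
  factor : ∀ z ∈ M, (∀ x ∈ M, z * x = x * z) → ∃ c : ℂ, z = c • (1 : H →L[ℂ] H)
  infinite : ¬ FiniteDimensional ℂ M.toStarSubalgebra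

/-- `A` is a maximal abelian self-adjoint subalgebra of `M`. -/
structure IsMasa {H : Type*} [NormedAddCommGroup H] [InnerProductSpace ℂ H]
    [CompleteSpace H] (A M : VonNeumannAlgebra H) : Prop where
  le : A ≤ M
  comm : ∀ a ∈ A, ∀ b ∈ A, a * b = b * a
  maximal : ∀ B : StarSubalgebra ℂ (H →L[ℂ] H), (∀ b ∈ B, b ∈ M) →
    (∀ a ∈ B, ∀ b ∈ B, a * b = b * a) → (∀ a ∈ A, a ∈ B) → ∀ b ∈ B, b ∈ A

/-- `L²(A)`, the closure of `A Ω` in `L²(M) = H`. -/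
noncomputable def masaL2 {H : Type*} [NormedAddCommGroup H] [InnerProductSpace ℂ H]
    [CompleteSpace H] (A : VonNeumannAlgebra H) (Ω : H) : Submodule ℂ H :=
  (A.toStarSubalgebra.toSubalgebra.toSubmodule.map
    (ContinuousLinearMap.apply ℂ H Ω).toLinearMap).topologicalClosure

instance {H : Type*} [NormedAddCommGroup H] [InnerProductSpace ℂ H]
    [CompleteSpace H] (A : VonNeumannAlgebra H) (Ω : H) :
    (masaL2 A Ω).HasOrthogonalProjection := by
  have : CompleteSpace (masaL2 A Ω) :=
    (Submodule.isClosed_topologicalClosure _).completeSpace_coe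
  infer_instance

/-- The Jones projection `e_A : L²(M) → L²(A)`. -/
noncomputable def jonesProj {H : Type*} [NormedAddCommGroup H] [InnerProductSpace ℂ H]
    [CompleteSpace H] (A : VonNeumannAlgebra H) (Ω : H) : H →L[ℂ] H :=
  (masaL2 A Ω).starProjection

section
variable {H : Type*} [NormedAddCommGroup H] [InnerProductSpace ℂ H]
    [CompleteSpace H] {A M : VonNeumannAlgebra H} {Ω : H}

theorem masaL2_induction {p : H → Prop} (hp : IsClosed {v | p v})
    (h : ∀ a ∈ A, p (a Ω)) {v : H} (hv : v ∈ masaL2 A Ω) : p v := by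
  have : (masaL2 A Ω : Set H) ⊆ {v | p v} := by
    refine closure_minimal ?_ hp
    rintro _ ⟨a, ha, rfl⟩
    exact h a ha
  exact this hv

theorem apply_mem_masaL2 {a : H →L[ℂ] H} (ha : a ∈ A) : a Ω ∈ masaL2 A Ω :=
  subset_closure ⟨a, ha, rfl⟩

theorem jonesProj_mem (v : H) : jonesProj A Ω v ∈ masaL2 A Ω :=
  Submodule.starProjection_apply_mem _ _

theorem jonesProj_of_mem {v : H} (hv : v ∈ masaL2 A Ω) : jonesProj A Ω v = v :=
  Submodule.starProjection_eq_self_iff.2 hv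

theorem jonesProj_inner (v w : H) : ⟪jonesProj A Ω v, w⟫_ℂ = ⟪v, jonesProj A Ω w⟫_ℂ :=
  Submodule.inner_starProjection_left_eq_right _ _ _

theorem jonesProj_eq_zero {v : H} (h : ∀ c ∈ A, ⟪c Ω, v⟫_ℂ = 0) : jonesProj A Ω v = 0 := by
  have h2 : ∀ w ∈ masaL2 A Ω, ⟪w, v⟫_ℂ = 0 := fun w hw =>
    masaL2_induction (p := fun w => ⟪w, v⟫_ℂ = 0)
      (isClosed_eq (by fun_prop) continuous_const) h hw
  refine Submodule.eq_starProjection_of_mem_of_inner_eq_zero (zero_mem _) fun w hw => ?_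
  rw [sub_zero, ← inner_conj_symm, h2 w hw, map_zero]

theorem eq_of_mem_masaL2 {v w : H} (hv : v ∈ masaL2 A Ω) (hw : w ∈ masaL2 A Ω)
    (h : ∀ c ∈ A, ⟪c Ω, v⟫_ℂ = ⟪c Ω, w⟫_ℂ) : v = w := by
  have := jonesProj_eq_zero (A := A) (Ω := Ω) (v := v - w)
    (fun c hc => by rw [inner_sub_right, h c hc, sub_self])
  rw [jonesProj_of_mem (sub_mem hv hw)] at this
  exact sub_eq_zero.1 this

theorem masaL2_map {a : H →L[ℂ] H} (ha : a ∈ A) {v : H} (hv : v ∈ masaL2 A Ω) :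
    a v ∈ masaL2 A Ω :=
  masaL2_induction (p := fun v => a v ∈ masaL2 A Ω)
    ((Submodule.isClosed_topologicalClosure _).preimage a.continuous)
    (fun b hb => apply_mem_masaL2 (a := a * b) (mul_mem ha hb)) hv

theorem inner_star (a : H →L[ℂ] H) (v w : H) : ⟪v, star a w⟫_ℂ = ⟪a v, w⟫_ℂ :=
  ContinuousLinearMap.adjoint_inner_right a v w

theorem inner_star' (a : H →L[ℂ] H) (v w : H) : ⟪star a v, w⟫_ℂ = ⟪v, a w⟫_ℂ :=
  ContinuousLinearMap.adjoint_inner_left a w v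

theorem jonesProj_comm {a : H →L[ℂ] H} (ha : a ∈ A) (v : H) :
    jonesProj A Ω (a v) = a (jonesProj A Ω v) := by
  refine eq_of_mem_masaL2 (jonesProj_mem _) (masaL2_map ha (jonesProj_mem _)) fun c hc => ?_
  rw [← jonesProj_inner, jonesProj_of_mem (apply_mem_masaL2 hc), ← inner_star',
    ← inner_star' a, ← jonesProj_inner,
    jonesProj_of_mem (masaL2_map (star_mem ha) (apply_mem_masaL2 hc))]

theorem apply_ext_of_cut {S T : H →L[ℂ] H} (hS : ∀ v, S (jonesProj A Ω v) = S v)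
    (hT : ∀ v, T (jonesProj A Ω v) = T v) (h : ∀ b ∈ A, S (b Ω) = T (b Ω)) : S = T := by
  ext v
  rw [← hS, ← hT]
  exact masaL2_induction (p := fun v => S v = T v)
    (isClosed_eq S.continuous T.continuous) h (jonesProj_mem v)

/-- Operators on `L²(A)` commuting with `A` commute with each other. -/
theorem cut_commute (hA : IsMasa A M) {S T : H →L[ℂ] H}
    (hSc : ∀ a ∈ A, ∀ v, S (a v) = a (S v)) (hTc : ∀ a ∈ A, ∀ v, T (a v) = a (T v))
    (hS : ∀ v, S (jonesProj A Ω v) = S v) (hT : ∀ v, T (jonesProj A Ω v) = T v)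
    (hS' : ∀ v, jonesProj A Ω (S v) = S v) (hT' : ∀ v, jonesProj A Ω (T v) = T v) :
    S * T = T * S := by
  have hSm : ∀ v, S v ∈ masaL2 A Ω := fun v => hS' v ▸ jonesProj_mem _
  have hTm : ∀ v, T v ∈ masaL2 A Ω := fun v => hT' v ▸ jonesProj_mem _
  have hSstar : star S Ω ∈ masaL2 A Ω := by
    have : jonesProj A Ω (star S Ω) = star S Ω := by
      refine ext_inner_left ℂ fun v => ?_
      rw [← jonesProj_inner, inner_star, inner_star, hS]
    exact this ▸ jonesProj_mem _
  have hnorm : ∀ a ∈ A, ‖star a Ω‖ = ‖a Ω‖ := by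
    intro a ha
    have : ⟪star a Ω, star a Ω⟫_ℂ = ⟪a Ω, a Ω⟫_ℂ := by
      rw [inner_star', ← inner_star]
      have := congrArg (fun t : H →L[ℂ] H => t Ω) (hA.comm a ha (star a) (star_mem ha))
      exact congrArg _ this
    rw [inner_self_eq_norm_sq_to_K, inner_self_eq_norm_sq_to_K] at this
    have h2 : ‖star a Ω‖ ^ 2 = ‖a Ω‖ ^ 2 := by exact_mod_cast this
    exact (sq_eq_sq₀ (norm_nonneg _) (norm_nonneg _)).1 h2
  obtain ⟨s, hs, hslim⟩ := mem_closure_iff_seq_limit.1 (show S Ω ∈ closure _ from hSm Ω)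
  choose a ha has using hs
  have has' : ∀ n, a n Ω = s n := has
  replace ha : ∀ n, a n ∈ A := ha
  have hlim : Tendsto (fun n => a n Ω) atTop (𝓝 (S Ω)) := by simpa only [has'] using hslim
  have hc : CauchySeq (fun n => star (a n) Ω) := by
    have h1 := hlim.cauchySeq
    rw [Metric.cauchySeq_iff] at h1 ⊢
    intro ε hε
    obtain ⟨N, hN⟩ := h1 ε hε
    refine ⟨N, fun m hm n hn => ?_⟩
    have := hN m hm n hn
    rw [dist_eq_norm] at this ⊢
    have h2 := hnorm (a m - a n) (sub_mem (ha m) (ha n))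
    rw [star_sub] at h2
    simp only [sub_apply] at h2
    rwa [h2]
  obtain ⟨η, hη⟩ := cauchySeq_tendsto_of_complete hc
  have hηeq : η = star S Ω := by
    refine eq_of_mem_masaL2 (A := A) (Ω := Ω) ?_ hSstar fun c hc => ?_
    · exact (Submodule.isClosed_topologicalClosure _).mem_of_tendsto hη
        (Eventually.of_forall fun n => apply_mem_masaL2 (star_mem (ha n)))
    · have h1 : Tendsto (fun n => ⟪c Ω, star (a n) Ω⟫_ℂ) atTop (𝓝 ⟪c Ω, η⟫_ℂ) :=
        Filter.Tendsto.inner tendsto_const_nhds hη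
      have h2 : Tendsto (fun n => ⟪c (a n Ω), Ω⟫_ℂ) atTop (𝓝 ⟪c (S Ω), Ω⟫_ℂ) :=
        Filter.Tendsto.inner ((c.continuous.tendsto _).comp hlim) tendsto_const_nhds
      have h3 : (fun n => ⟪c Ω, star (a n) Ω⟫_ℂ) = fun n => ⟪c (a n Ω), Ω⟫_ℂ := by
        funext n
        rw [inner_star]
        exact congrArg (fun t : H →L[ℂ] H => ⟪t Ω, Ω⟫_ℂ) (hA.comm _ (ha n) _ hc)
      rw [h3] at h1
      rw [tendsto_nhds_unique h1 h2, inner_star, hSc c hc]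
  have key : ∀ d ∈ A, ⟪Ω, S (T (d Ω))⟫_ℂ = ⟪Ω, T (S (d Ω))⟫_ℂ := by
    intro d hd
    have h1 : Tendsto (fun n => ⟪star (a n) Ω, T (d Ω)⟫_ℂ) atTop (𝓝 ⟪η, T (d Ω)⟫_ℂ) :=
      Filter.Tendsto.inner hη tendsto_const_nhds
    have h2 : Tendsto (fun n => ⟪Ω, T (d (a n Ω))⟫_ℂ) atTop (𝓝 ⟪Ω, T (d (S Ω))⟫_ℂ) :=
      Filter.Tendsto.inner tendsto_const_nhds
        (((T.continuous.comp d.continuous).tendsto _).comp hlim)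
    have h3 : (fun n => ⟪star (a n) Ω, T (d Ω)⟫_ℂ) = fun n => ⟪Ω, T (d (a n Ω))⟫_ℂ := by
      funext n
      rw [inner_star', ← hTc _ (ha n)]
      exact congrArg (fun t : H →L[ℂ] H => ⟪Ω, T (t Ω)⟫_ℂ) (hA.comm _ (ha n) _ hd)
    rw [h3] at h1
    have h4 := tendsto_nhds_unique h1 h2
    rw [hηeq, inner_star'] at h4
    rw [h4, ← hSc d hd]
  refine apply_ext_of_cut (A := A) (Ω := Ω) (fun v => ?_) (fun v => ?_) fun b hb => ?_
  · change S (T (jonesProj A Ω v)) = S (T v)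
    rw [hT]
  · change T (S (jonesProj A Ω v)) = T (S v)
    rw [hS]
  · refine eq_of_mem_masaL2 (A := A) (Ω := Ω) (hSm _) (hTm _) fun c hc => ?_
    change ⟪c Ω, S (T (b Ω))⟫_ℂ = ⟪c Ω, T (S (b Ω))⟫_ℂ
    rw [← inner_star, ← inner_star c, ← hSc _ (star_mem hc), ← hTc _ (star_mem hc),
      ← hTc _ (star_mem hc), ← hSc _ (star_mem hc)]
    exact key _ (mul_mem (star_mem hc) hb)

/-- The Jones projection maps `M` into `A`. -/
theorem exists_masaCondExp (hM : IsIIOneStandardForm M Ω) (hA : IsMasa A M) {z : H →L[ℂ] H}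
    (hz : z ∈ M) : ∃ a ∈ A, a Ω = jonesProj A Ω (z Ω) := by
  set e := jonesProj A Ω with he
  have hee : ∀ v, e (e v) = e v := fun v => jonesProj_of_mem (jonesProj_mem _)
  have hΩ : e Ω = Ω := jonesProj_of_mem (apply_mem_masaL2 (a := 1) (one_mem A))
  have cutcomm : ∀ s : H →L[ℂ] H, (∀ a ∈ A, ∀ w ∈ masaL2 A Ω, e (s (a w)) = e (a (s w))) →
      ∀ a ∈ A, ∀ v, (e * s * e) (a v) = a ((e * s * e) v) := by
    intro s hs a ha v
    change e (s (e (a v))) = a (e (s (e v)))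
    rw [he, jonesProj_comm ha, ← he, hs a ha _ (jonesProj_mem _), he, jonesProj_comm ha]
  set T := e * z * e with hTdef
  have hTc : ∀ a ∈ A, ∀ v, T (a v) = a (T v) := by
    refine cutcomm z fun a ha w hw => ?_
    refine masaL2_induction (p := fun w => e (z (a w)) = e (a (z w)))
      (isClosed_eq (by fun_prop) (by fun_prop)) (fun b hb => ?_) hw
    rw [← sub_eq_zero, ← map_sub]
    refine jonesProj_eq_zero fun c hc => ?_
    have haM := hA.le ha
    have hbM := hA.le hb
    have hcM := hA.le (star_mem hc : star c ∈ A)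
    rw [inner_sub_right, sub_eq_zero]
    have e0 : ∀ w : H, ⟪c Ω, w⟫_ℂ = ⟪Ω, star c w⟫_ℂ := fun w => (inner_star c Ω w).symm
    rw [e0, e0]
    have e1 := hM.trace_comm (star c * z) (mul_mem hcM hz) (a * b) (mul_mem haM hbM)
    have e2 := hM.trace_comm (star c * a * z) (mul_mem (mul_mem hcM haM) hz) b hbM
    have e3 : a * b * (star c * z) = b * (star c * a * z) := by
      rw [← mul_assoc, hA.comm a ha b hb, mul_assoc b a,
        hA.comm a ha _ (star_mem hc)]
      simp only [mul_assoc]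
    rw [e3, ← e2] at e1
    simpa using e1
  have hTcut : ∀ v, T (e v) = T v := fun v => by
    change e (z (e (e v))) = e (z (e v)); rw [hee]
  have hTcut' : ∀ v, e (T v) = T v := fun v => hee _
  have hTΩ : T Ω = e (z Ω) := by change e (z (e Ω)) = _; rw [hΩ]
  set ξ := e (z Ω)
  -- commutant of `A`
  let N := A.commutant
  let ev : N.toStarSubalgebra.toSubalgebra.toSubmodule →ₗ[ℂ] H :=
    (ContinuousLinearMap.apply ℂ H Ω).toLinearMap.comp (Submodule.subtype _)
  let fx : N.toStarSubalgebra.toSubalgebra.toSubmodule →ₗ[ℂ] H :=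
    (ContinuousLinearMap.apply ℂ H ξ).toLinearMap.comp (Submodule.subtype _)
  have hev : ∀ m, ev m = m.1 Ω := fun _ => rfl
  have hfx : ∀ m, fx m = m.1 ξ := fun _ => rfl
  have hN : ∀ m ∈ N, ∀ a ∈ A, ∀ v, m (a v) = a (m v) := by
    intro m hm a ha v
    have := VonNeumannAlgebra.mem_commutant_iff.1 hm a ha
    exact (congrArg (fun t : H →L[ℂ] H => t v) this).symm
  have hbound : ∀ m, ‖fx m‖ ≤ ‖T‖ * ‖ev m‖ := by
    rintro ⟨m, hm⟩
    replace hm : m ∈ N := hm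
    rw [hfx, hev]
    change ‖m ξ‖ ≤ ‖T‖ * ‖m Ω‖
    have hs : star m * m ∈ N := mul_mem (star_mem hm) hm
    set S := e * (star m * m) * e with hSdef
    have hSc : ∀ a ∈ A, ∀ v, S (a v) = a (S v) := by
      refine cutcomm _ fun a ha w _ => ?_
      rw [hN _ hs a ha]
    have hScut : ∀ v, S (e v) = S v := fun v => by
      change e ((star m * m) (e (e v))) = e ((star m * m) (e v)); rw [hee]
    have hcomm : S * T = T * S := cut_commute hA hSc hTc hScut hTcut (fun v => hee _) hTcut'
    have hesa : star e = e := by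
      refine ContinuousLinearMap.ext fun v => ext_inner_left ℂ fun w => ?_
      rw [inner_star, he, jonesProj_inner]
    have hSpos : 0 ≤ S := by
      have : S = star (m * e) * (m * e) := by
        rw [hSdef, star_mul, hesa]; simp only [mul_assoc]
      rw [this]; exact star_mul_self_nonneg _
    have hSsa : star S = S := (IsSelfAdjoint.of_nonneg hSpos).star_eq
    have hcomm' : S * star T = star T * S := by
      have := congrArg star hcomm
      rw [star_mul S T, star_mul T S, hSsa] at this
      exact this.symm
    have hDpos : 0 ≤ ((‖T‖ ^ 2 : ℝ) : ℂ) • (1 : H →L[ℂ] H) - star T * T := by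
      have := CStarAlgebra.star_mul_le_algebraMap_norm_sq (a := T)
      rw [sub_nonneg]
      convert this using 1
      rw [Algebra.algebraMap_eq_smul_one]
      ext v; simp; norm_cast
    have hcommD : Commute S (((‖T‖ ^ 2 : ℝ) : ℂ) • (1 : H →L[ℂ] H) - star T * T) := by
      refine Commute.sub_right ((Commute.one_right S).smul_right _) ?_
      exact Commute.mul_right hcomm' hcomm
    have hprod := Commute.mul_nonneg hSpos hDpos hcommD
    have hp := (ContinuousLinearMap.nonneg_iff_isPositive _).1 hprod
    have hp2 := hp.re_inner_nonneg_right Ω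
    have e1 : ∀ w, w ∈ masaL2 A Ω → ⟪w, S w⟫_ℂ = ((‖m w‖ ^ 2 : ℝ) : ℂ) := by
      intro w hw
      change ⟪w, e (star m (m (e w)))⟫_ℂ = _
      rw [he, ← jonesProj_inner, jonesProj_of_mem hw, inner_star,
        inner_self_eq_norm_sq_to_K]
      simp
    have hTm : T Ω ∈ masaL2 A Ω := hTΩ ▸ jonesProj_mem _
    have hΩm : Ω ∈ masaL2 A Ω := apply_mem_masaL2 (a := 1) (one_mem A)
    have e2 : ⟪Ω, (S * (((‖T‖ ^ 2 : ℝ) : ℂ) • (1 : H →L[ℂ] H) - star T * T)) Ω⟫_ℂ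
        = ((‖T‖ ^ 2 * ‖m Ω‖ ^ 2 - ‖m ξ‖ ^ 2 : ℝ) : ℂ) := by
      have e3 : S (star T (T Ω)) = star T (S (T Ω)) :=
        congrArg (fun t : H →L[ℂ] H => t (T Ω)) hcomm'
      have e4 := e1 Ω hΩm
      have e5 := e1 (T Ω) hTm
      rw [hTΩ] at e3 e5
      simp only [mul_apply_eq_comp, sub_apply,
        smul_apply, one_apply_eq_self, map_sub, map_smul,
        inner_sub_right, inner_smul_right, hTΩ]
      rw [e4, e3, inner_star, hTΩ, e5]
      push_cast; ring
    rw [e2] at hp2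
    have hp3 : ‖m ξ‖ ^ 2 ≤ (‖T‖ * ‖m Ω‖) ^ 2 := by
      have : 0 ≤ ‖T‖ ^ 2 * ‖m Ω‖ ^ 2 - ‖m ξ‖ ^ 2 := by
        rwa [RCLike.re_to_complex, Complex.ofReal_re] at hp2
      nlinarith
    exact (sq_le_sq₀ (norm_nonneg _) (by positivity)).1 hp3
  have hdense : DenseRange ev := by
    let K := (LinearMap.range ev).topologicalClosure
    have : CompleteSpace K := (Submodule.isClosed_topologicalClosure _).completeSpace_coe
    have hKinv : ∀ y ∈ A.commutant, K ∈ Module.End.invtSubmodule (y : H →ₗ[ℂ] H) := by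
      intro y hy
      rw [Module.End.mem_invtSubmodule_iff_forall_mem_of_mem]
      intro v hv
      have hcl : IsClosed {v | y v ∈ K} :=
        (Submodule.isClosed_topologicalClosure _).preimage y.continuous
      have : (K : Set H) ⊆ {v | y v ∈ K} := by
        refine closure_minimal ?_ hcl
        rintro _ ⟨m, rfl⟩
        exact subset_closure ⟨⟨y * m.1, mul_mem (S := VonNeumannAlgebra H) (s := N) hy m.2⟩, rfl⟩
      exact this hv
    have hp : K.starProjection ∈ A := by
      rw [VonNeumannAlgebra.IsStarProjection.mem_iff isStarProjection_starProjection]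
      intro y hy
      rw [Submodule.range_starProjection]
      exact hKinv y hy
    have hΩK : Ω ∈ K := subset_closure ⟨⟨1, one_mem N⟩, rfl⟩
    have hq : (1 : H →L[ℂ] H) - K.starProjection = 0 := by
      refine hM.faithful _ (hA.le (sub_mem (one_mem A) hp)) ?_
      have : ((1 : H →L[ℂ] H) - K.starProjection) Ω = 0 := by
        simp [Submodule.starProjection_eq_self_iff.2 hΩK]
      rw [mul_apply_eq_comp, this, map_zero, inner_zero_right]
    intro v
    have : K.starProjection v = v := by
      have := congrArg (fun t : H →L[ℂ] H => t v) hq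
      exact (sub_eq_zero.1 this).symm
    exact (this ▸ Submodule.starProjection_apply_mem K v : v ∈ K)
  let a : H →L[ℂ] H := fx.extendOfNorm ev
  have haev : ∀ m ∈ N, a (m Ω) = m ξ := fun m hm =>
    LinearMap.extendOfNorm_eq hdense ⟨_, hbound⟩ ⟨m, hm⟩
  refine ⟨a, ?_, by simpa using haev 1 (one_mem N)⟩
  rw [← VonNeumannAlgebra.commutant_commutant A, VonNeumannAlgebra.mem_commutant_iff]
  intro n hn
  ext v
  refine hdense.induction_on (p := fun v => (n * a) v = (a * n) v) v
    (isClosed_eq (by fun_prop) (by fun_prop)) fun m => ?_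
  change n (a (m.1 Ω)) = a ((n * m.1) Ω)
  rw [haev m.1 m.2, haev _ (mul_mem hn m.2)]
  rfl

/-- The trace-preserving normal conditional expectation `E_A : M → A`, the restriction to `M` of
the Jones projection: `E_A z` is the unique element of `A` with `(E_A z) Ω = e_A (z Ω)`. -/
noncomputable def masaCondExp (hM : IsIIOneStandardForm M Ω) (hA : IsMasa A M) (z : H →L[ℂ] H)
    (hz : z ∈ M) : H →L[ℂ] H :=
  (exists_masaCondExp hM hA hz).choose

theorem masaCondExp_mem (hM : IsIIOneStandardForm M Ω) (hA : IsMasa A M) {z : H →L[ℂ] H}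
    (hz : z ∈ M) : masaCondExp hM hA z hz ∈ A :=
  (exists_masaCondExp hM hA hz).choose_spec.1

theorem masaCondExp_apply (hM : IsIIOneStandardForm M Ω) (hA : IsMasa A M) {z : H →L[ℂ] H}
    (hz : z ∈ M) : masaCondExp hM hA z hz Ω = jonesProj A Ω (z Ω) :=
  (exists_masaCondExp hM hA hz).choose_spec.2

/-- `τ (c E_A(z)) = τ (c z)` for `c ∈ A`, which characterizes `E_A`. -/
theorem trace_mul_masaCondExp (hM : IsIIOneStandardForm M Ω) (hA : IsMasa A M) {z : H →L[ℂ] H}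
    (hz : z ∈ M) {c : H →L[ℂ] H} (hc : c ∈ A) :
    ⟪Ω, (c * masaCondExp hM hA z hz) Ω⟫_ℂ = ⟪Ω, (c * z) Ω⟫_ℂ := by
  rw [mul_apply_eq_comp, mul_apply_eq_comp, masaCondExp_apply, ← inner_star', ← inner_star' c,
    ← jonesProj_inner, jonesProj_of_mem (apply_mem_masaL2 (star_mem hc))]

end

section
variable {H : Type*} [NormedAddCommGroup H] [InnerProductSpace ℂ H] [CompleteSpace H]
  {X : Type*} [TopologicalSpace X] [CompactSpace X] [T2Space X] [SecondCountableTopology X]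
  [MeasurableSpace X] [BorelSpace X]

/-- `ι` embeds `C(X)` (`X` compact metrizable) as a unital, norm separable `C*`-subalgebra of `A`
that is dense in the weak operator topology, and `lam` is the tracial measure on `X`. -/
structure IsMasaCoordinates (A : VonNeumannAlgebra H) (Ω : H)
    (ι : C(X, ℂ) →⋆ₐ[ℂ] (H →L[ℂ] H)) (lam : Measure X) : Prop where
  injective : Function.Injective ι
  mem : ∀ f, ι f ∈ A
  dense : ∀ a ∈ A, ContinuousLinearMapWOT.ofCLM a ∈
    closure (Set.range fun f : C(X, ℂ) => ContinuousLinearMapWOT.ofCLM (ι f))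
  integral_eq : ∀ f : C(X, ℂ), ∫ t, f t ∂lam = ⟪Ω, ι f Ω⟫_ℂ

/-- The element `a` of `A` is the function `φ` under the identification `A ≅ L^∞(X, lam)` that
extends `ι`: on `L²(A)`, identified with `L²(X, lam)` through `ι g Ω ↔ g`, the operator `a` acts as
multiplication by `φ`. This determines `φ` up to a `lam`-null set. -/
def IsFunctionOf (Ω : H) (ι : C(X, ℂ) →⋆ₐ[ℂ] (H →L[ℂ] H)) (lam : Measure X)
    (a : H →L[ℂ] H) (φ : X → ℂ) : Prop :=
  MemLp φ ∞ lam ∧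
    ∀ g h : C(X, ℂ), ⟪ι g Ω, a (ι h Ω)⟫_ℂ = ∫ t, star (g t) * φ t * h t ∂lam

end

/-- The direct integral over `(Y, η)` of Hilbert spaces of dimension `m p` at `p`: the square
integrable sections of `ℓ²(ℕ)` whose value at `p` is supported on the first `m p` coordinates. -/
noncomputable def directIntegral {Y : Type*} [MeasurableSpace Y] (η : Measure Y) (m : Y → ℕ∞) :
    Submodule ℂ (Lp (lp (fun _ : ℕ => ℂ) 2) 2 η) where
  carrier := {F | ∀ᵐ p ∂η, ∀ i : ℕ, m p ≤ i → F p i = 0}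
  zero_mem' := by
    filter_upwards [Lp.coeFn_zero (lp (fun _ : ℕ => ℂ) 2) 2 η] with p hp i _
    rw [hp]; rfl
  add_mem' := by
    intro F G hF hG
    filter_upwards [hF, hG, Lp.coeFn_add F G] with p h1 h2 h3 i hi
    rw [h3, Pi.add_apply, lp.coeFn_add, Pi.add_apply, h1 i hi, h2 i hi, add_zero]
  smul_mem' := by
    intro c F hF
    filter_upwards [hF, Lp.coeFn_smul c F] with p h1 h2 i hi
    rw [h2, Pi.smul_apply, lp.coeFn_smul, Pi.smul_apply, h1 i hi, smul_zero]

section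
variable {H : Type*} [NormedAddCommGroup H] [InnerProductSpace ℂ H] [CompleteSpace H]
  {X : Type*} [TopologicalSpace X] [CompactSpace X] [T2Space X] [SecondCountableTopology X]
  [MeasurableSpace X] [BorelSpace X]

/-- The finite measure `η` on `X × X` and the multiplicity function `m` come from a direct integral
decomposition `W` of `L²(M)`, with nonzero fibres, as a bimodule over `A`: the left action of
`f ∈ C(X)` and the right action of `g ∈ C(X)` become multiplication by `f(t) g(s)`. (It is enough
to say this on the dense subspace `M Ω`, where `f · x · g = (f x g) Ω`.) Hence the diagonalizable
operators are exactly the von Neumann algebra generated by the left and right actions of `A`. -/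
def IsMeasureMultiplicity (M : VonNeumannAlgebra H) (Ω : H)
    (ι : C(X, ℂ) →⋆ₐ[ℂ] (H →L[ℂ] H)) (η : Measure (X × X)) (m : X × X → ℕ∞) : Prop :=
  IsFiniteMeasure η ∧ Measurable m ∧ (∀ᵐ p ∂η, m p ≠ 0) ∧
    ∃ W : H ≃ₗᵢ[ℂ] directIntegral η m, ∀ x ∈ M, ∀ f g : C(X, ℂ),
      ∀ᵐ p ∂η, (W ((ι f * x * ι g) Ω)).1 p = (f p.1 * g p.2) • (W (x Ω)).1 p

/-- The left-right measure, that is the class of `η` restricted to the complement of the diagonal,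
is the class of the product measure. -/
def IsProductClass (M : VonNeumannAlgebra H) (Ω : H)
    (ι : C(X, ℂ) →⋆ₐ[ℂ] (H →L[ℂ] H)) (lam : Measure X) : Prop :=
  ∃ (η : Measure (X × X)) (m : X × X → ℕ∞), IsMeasureMultiplicity M Ω ι η m ∧
    η.restrict (Set.diagonal X)ᶜ ≪ lam.prod lam ∧ lam.prod lam ≪ η.restrict (Set.diagonal X)ᶜ

end

/-! The point is that `E_A(x · y*)` restricted to `A ≅ L^∞(X, λ)` is an integral operator with
kernel `k ∈ L¹(λ ⊗ λ)`: the function of `E_A(x u y*)` is `t ↦ ∫ k(t, s) u(s) dλ(s)`. By Fubini `k(t,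
·)` is integrable for almost every `t`, and on `L^∞` a bounded, weak operator null sequence is
weak-* null. Hence the integrals tend to `0` for each such `t`, outside a null set that serves all
`n`.

The kernel comes from the bimodule decomposition of `L²(M)`. There `⟪yΩ, f x g Ω⟫` is the integral
of `f(t) g(s)` times the fibrewise inner product of `yΩ` and `xΩ` against `η`. Off the diagonal `η`
has a density with respect to `λ ⊗ λ`, so `k` exists as soon as the diagonal contributes nothing
(`exists_bimodule_density`). The trace and Fubini then identify the conditional expectation
(`toFun_masaCondExp_ae_eq`).

The main step is therefore that `xΩ` has no diagonal part when `x` is orthogonal to `A`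
(`ae_eq_zero_of_mem_diagonal`). Average `x` repeatedly over conjugations by unitaries of `C(X)` that
separate points. In the decomposition the averages are multiplied by functions tending boundedly to
the indicator of the diagonal, so they converge weakly to the diagonal part of `xΩ`. The averages
are bounded in norm, so this limit is `aΩ` with `a ∈ M`. Being supported on the diagonal, `a`
commutes with `C(X)`, hence lies in the masa `A`. Averaging preserves orthogonality to `A`, so `a =
0`. -/

theorem ContinuousMap.integrable_mul {X : Type*} [TopologicalSpace X] [CompactSpace X]
    [MeasurableSpace X] [BorelSpace X] {lam : Measure X} (f : C(X, ℂ)) {q : X → ℂ} (hq : Integrable q lam) :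
    Integrable (fun t => f t * q t) lam :=
  hq.bdd_mul f.continuous.aestronglyMeasurable (ae_of_all _ fun t => f.norm_coe_le_norm t)

/-! ### Testing functions on `X` against continuous functions -/

section ContinuousTests
variable {X : Type*} [TopologicalSpace X] [CompactSpace X] [T2Space X] [SecondCountableTopology X]
  [MeasurableSpace X] [BorelSpace X] {lam : Measure X}

/-- An integrable function on a compact metrizable space is determined by its integrals against
continuous functions. -/
theorem ae_eq_zero_of_forall_integral_continuous_mul {q : X → ℂ} (hq : Integrable q lam)
    (h : ∀ f : C(X, ℂ), ∫ t, f t * q t ∂lam = 0) : q =ᵐ[lam] 0 := by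
  refine ae_eq_zero_of_forall_setIntegral_isClosed_eq_zero hq fun s hs => ?_
  rw [← integral_indicator hs.measurableSet]
  -- Continuous functions bounded by `1` that converge pointwise to the indicator of the closed set
  -- `s`.
  let f : ℕ → C(X, ℂ) := fun n =>
    ⟨fun t => ((hs.apprSeq n t : ℝ) : ℂ),
      Complex.continuous_ofReal.comp (NNReal.continuous_coe.comp (hs.apprSeq n).continuous)⟩
  have hlim : Tendsto (fun n => ∫ t, f n t * q t ∂lam) atTop (𝓝 (∫ t, s.indicator q t ∂lam)) := by
    refine tendsto_integral_of_dominated_convergence (fun t => ‖q t‖)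
      (fun n => ((f n).integrable_mul hq).aestronglyMeasurable) hq.norm
      (fun n => ae_of_all _ fun t => ?_) (ae_of_all _ fun t => ?_)
    · rw [norm_mul]
      have : ‖f n t‖ ≤ 1 := by
        change ‖((hs.apprSeq n t : ℝ) : ℂ)‖ ≤ 1
        simpa using HasOuterApproxClosed.apprSeq_apply_le_one hs n t
      exact mul_le_of_le_one_left (norm_nonneg _) this
    · have h1 := tendsto_pi_nhds.1 (HasOuterApproxClosed.tendsto_apprSeq hs) t
      have h2 := ((Complex.continuous_ofReal.comp NNReal.continuous_coe).tendsto _).comp h1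
      have h3 := h2.mul_const (q t)
      have h4 : (Complex.ofReal ∘ NNReal.toReal) (s.indicator (fun _ => 1) t) * q t
          = s.indicator q t := by
        by_cases ht : t ∈ s <;> simp [ht]
      rwa [h4] at h3
  simp only [h] at hlim
  exact (tendsto_nhds_unique hlim tendsto_const_nhds)

theorem ae_eq_of_forall_integral_continuous_mul {q r : X → ℂ} (hq : Integrable q lam)
    (hr : Integrable r lam) (h : ∀ f : C(X, ℂ), ∫ t, f t * q t ∂lam = ∫ t, f t * r t ∂lam) :
    q =ᵐ[lam] r := by
  have := ae_eq_zero_of_forall_integral_continuous_mul (hq.sub hr) fun f => by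
    simp only [Pi.sub_apply, mul_sub]
    rw [integral_sub (f.integrable_mul hq) (f.integrable_mul hr), h f, sub_self]
  filter_upwards [this] with t ht
  exact sub_eq_zero.1 ht

/-- A multiplier of `L²` of norm at most `K` is essentially bounded by `K`. -/
theorem ae_enorm_le_of_forall_lintegral_continuous_mul [IsFiniteMeasure lam]
    {q : X → ℂ}
    (hq : AEStronglyMeasurable q lam) {K : ℝ≥0∞} (hK : K ≠ ∞)
    (h : ∀ f : C(X, ℂ), ∫⁻ t, ‖f t * q t‖ₑ ^ 2 ∂lam ≤ K ^ 2 * ∫⁻ t, ‖f t‖ₑ ^ 2 ∂lam) :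
    ∀ᵐ t ∂lam, ‖q t‖ₑ ≤ K := by
  have hqm : AEMeasurable (fun t => ‖q t‖ₑ ^ 2) lam := hq.enorm.pow_const 2
  -- The claim amounts to `ν ≤ K² lam`. The hypothesis gives this on closed sets, and inner
  -- regularity carries it to all Borel sets.
  set ν := lam.withDensity fun t => ‖q t‖ₑ ^ 2 with hν
  have hfin : ∫⁻ t, ‖q t‖ₑ ^ 2 ∂lam ≠ ∞ := by
    have := h 1
    simp only [ContinuousMap.one_apply, one_mul, enorm_one, one_pow, lintegral_one] at this
    exact ne_top_of_le_ne_top (ENNReal.mul_ne_top (ENNReal.pow_ne_top hK) (measure_ne_top _ _)) this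
  have : IsFiniteMeasure ν := isFiniteMeasure_withDensity hfin
  have hclosed : ∀ s, IsClosed s → ν s ≤ K ^ 2 * lam s := by
    intro s hs
    refine ge_of_tendsto' (ENNReal.Tendsto.const_mul
      (HasOuterApproxClosed.tendsto_lintegral_apprSeq hs lam)
      (Or.inr (ENNReal.pow_ne_top hK))) fun n => ?_
    refine (HasOuterApproxClosed.measure_le_lintegral hs ν n).trans ?_
    -- The square root makes `|f|²` equal to the approximant of the indicator.
    let f : C(X, ℂ) := ⟨fun t => ((NNReal.sqrt (hs.apprSeq n t) : ℝ) : ℂ),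
      Complex.continuous_ofReal.comp (NNReal.continuous_coe.comp
        (NNReal.continuous_sqrt.comp (hs.apprSeq n).continuous))⟩
    have hf : ∀ t, ‖f t‖ₑ ^ 2 = (hs.apprSeq n t : ℝ≥0∞) := by
      intro t
      have h1 : ‖f t‖ₑ = (NNReal.sqrt (hs.apprSeq n t) : ℝ≥0∞) := by
        rw [enorm_eq_nnnorm]
        congr 1
        ext
        change ‖((NNReal.sqrt (hs.apprSeq n t) : ℝ) : ℂ)‖ = _
        simp
      rw [h1, ← ENNReal.coe_pow, NNReal.sq_sqrt]
    have h2 := h f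
    simp only [enorm_mul, mul_pow, hf] at h2
    refine le_trans (le_of_eq ?_) h2
    rw [hν, lintegral_withDensity_eq_lintegral_mul₀ hqm]
    · simp only [Pi.mul_apply, mul_comm]
    · exact (ENNReal.continuous_coe.comp (hs.apprSeq n).continuous).aemeasurable
  have hle : (fun t => ‖q t‖ₑ ^ 2) ≤ᵐ[lam] fun _ => K ^ 2 := by
    refine ae_le_of_forall_setLIntegral_le_of_sigmaFinite₀ hqm fun s hs _ => ?_
    rw [setLIntegral_const, ← withDensity_apply _ hs, ← hν,
      hs.measure_eq_iSup_isClosed_of_ne_top (measure_ne_top _ _)]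
    refine iSup_le fun F => iSup_le fun hF => iSup_le fun hFc => (hclosed F hFc).trans ?_
    gcongr
  filter_upwards [hle] with t ht
  exact (ENNReal.pow_le_pow_left_iff two_ne_zero).1 ht

/-- A bounded sequence in `L^∞` whose integrals against continuous functions tend to zero is
weak-* null. -/
theorem tendsto_integral_mul_of_forall_continuous [IsFiniteMeasure lam]
    {ψ : ℕ → X → ℂ} {C : ℝ}
    (hψm : ∀ n, AEStronglyMeasurable (ψ n) lam) (hψ : ∀ n, ∀ᵐ t ∂lam, ‖ψ n t‖ ≤ C)
    (h : ∀ f : C(X, ℂ), Tendsto (fun n => ∫ t, f t * ψ n t ∂lam) atTop (𝓝 0))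
    {k : X → ℂ} (hk : Integrable k lam) :
    Tendsto (fun n => ∫ t, k t * ψ n t ∂lam) atTop (𝓝 0) := by
  rw [Metric.tendsto_atTop]
  intro ε hε
  -- `C` need not be positive, whereas `|C| + 1` is a bound by which `ε` can be divided.
  have hC : 0 < |C| + 1 := by positivity
  obtain ⟨g, hg, hgi⟩ := hk.exists_boundedContinuous_integral_sub_le
    (show 0 < ε / (2 * (|C| + 1)) by positivity)
  obtain ⟨N, hN⟩ := (Metric.tendsto_atTop.1 (h g.toContinuousMap)) (ε / 2) (by positivity)
  refine ⟨N, fun n hn => ?_⟩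
  have h1 : Integrable (fun t => k t * ψ n t) lam := hk.mul_bdd (hψm n) (hψ n)
  have h2 : Integrable (fun t => g t * ψ n t) lam := hgi.mul_bdd (hψm n) (hψ n)
  have h3 := hN n hn
  rw [dist_zero_right] at h3 ⊢
  have h4 : ∫ t, k t * ψ n t ∂lam
      = (∫ t, (k t - g t) * ψ n t ∂lam) + ∫ t, g t * ψ n t ∂lam := by
    simp only [sub_mul]
    rw [integral_sub h1 h2, sub_add_cancel]
  have h5 : ‖∫ t, (k t - g t) * ψ n t ∂lam‖ ≤ ε / (2 * (|C| + 1)) * (|C| + 1) := by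
    refine (norm_integral_le_of_norm_le (g := fun t => ‖k t - g t‖ * (|C| + 1))
      ((hk.sub hgi).norm.mul_const _) ?_).trans ?_
    · filter_upwards [hψ n] with t ht
      rw [norm_mul]
      gcongr
      exact ht.trans ((le_abs_self C).trans (by linarith))
    · rw [integral_mul_const]
      gcongr
  rw [h4]
  have h6 : ε / (2 * (|C| + 1)) * (|C| + 1) = ε / 2 := by field_simp
  calc _ ≤ _ := norm_add_le _ _
    _ < ε / 2 + ε / 2 := add_lt_add_of_le_of_lt (h6 ▸ h5) h3
    _ = ε := add_halves ε

end ContinuousTests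

/-! ### `L²(A)` as `L²(X, lam)`, and elements of `A` as bounded functions -/

theorem inner_map_star {H : Type*} [NormedAddCommGroup H] [InnerProductSpace ℂ H] [CompleteSpace H]
    {X : Type*} [TopologicalSpace X] (ι : C(X, ℂ) →⋆ₐ[ℂ] (H →L[ℂ] H)) (f : C(X, ℂ)) (v w : H) :
    ⟪ι (star f) v, w⟫_ℂ = ⟪v, ι f w⟫_ℂ := by
  rw [map_star, inner_star']

theorem enorm_sq_eq_lintegral {X : Type*} [MeasurableSpace X] {lam : Measure X}
    (ξ : Lp ℂ 2 lam) : ‖ξ‖ₑ ^ 2 = ∫⁻ t, ‖ξ t‖ₑ ^ 2 ∂lam := by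
  have := eLpNorm_nnreal_pow_eq_lintegral (μ := lam) (f := ξ) (p := 2) two_ne_zero
  rw [Lp.enorm_def]
  simpa using this

section MasaCoordinates
variable {H : Type*} [NormedAddCommGroup H] [InnerProductSpace ℂ H] [CompleteSpace H]
  {A M : VonNeumannAlgebra H} {Ω : H}
  {X : Type*} [TopologicalSpace X] [CompactSpace X]
  [MeasurableSpace X] [BorelSpace X] {ι : C(X, ℂ) →⋆ₐ[ℂ] (H →L[ℂ] H)} {lam : Measure X}
  [IsProbabilityMeasure lam]

theorem IsMasaCoordinates.inner_eq (hX : IsMasaCoordinates A Ω ι lam) (f g : C(X, ℂ)) :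
    ⟪ι f Ω, ι g Ω⟫_ℂ
      = ⟪ContinuousMap.toLp 2 lam ℂ f, ContinuousMap.toLp 2 lam ℂ g⟫_ℂ := by
  rw [ContinuousMap.inner_toLp, ← inner_star, ← map_star]
  change ⟪Ω, (ι (star f) * ι g) Ω⟫_ℂ = _
  rw [← map_mul, ← hX.integral_eq]
  refine integral_congr_ae (ae_of_all _ fun t => ?_)
  simp [mul_comm]

theorem IsMasaCoordinates.norm_eq (hX : IsMasaCoordinates A Ω ι lam) (f : C(X, ℂ)) :
    ‖ι f Ω‖ = ‖ContinuousMap.toLp (E := ℂ) 2 lam ℂ f‖ := by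
  rw [@norm_eq_sqrt_re_inner ℂ, @norm_eq_sqrt_re_inner ℂ, hX.inner_eq]

variable [T2Space X] [SecondCountableTopology X]

/-- The isometry `L²(X, lam) → L²(M)` with range `L²(A)` that extends `f ↦ ι f Ω`. -/
noncomputable def IsMasaCoordinates.isometry (hX : IsMasaCoordinates A Ω ι lam) :
    Lp ℂ 2 lam →ₗᵢ[ℂ] H where
  toLinearMap := (((ContinuousLinearMap.apply ℂ H Ω).toLinearMap.comp
    ι.toAlgHom.toLinearMap).extendOfNorm (ContinuousMap.toLp (E := ℂ) 2 lam ℂ).toLinearMap)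
  norm_map' := by
    have hd : DenseRange (ContinuousMap.toLp (E := ℂ) 2 lam ℂ) :=
      ContinuousMap.toLp_denseRange ℂ lam ℂ (by simp)
    intro ξ
    refine hd.induction_on (p := fun ξ => ‖(((ContinuousLinearMap.apply ℂ H Ω).toLinearMap.comp
      ι.toAlgHom.toLinearMap).extendOfNorm (ContinuousMap.toLp (E := ℂ) 2 lam ℂ).toLinearMap) ξ‖
        = ‖ξ‖) ξ (isClosed_eq (by fun_prop) (by fun_prop)) fun f => ?_
    have := LinearMap.extendOfNorm_eq (f := (ContinuousLinearMap.apply ℂ H Ω).toLinearMap.comp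
      ι.toAlgHom.toLinearMap) (e := (ContinuousMap.toLp (E := ℂ) 2 lam ℂ).toLinearMap) hd
      ⟨1, fun f => by rw [one_mul]; exact (hX.norm_eq f).le⟩ f
    exact (congrArg norm this).trans (hX.norm_eq f)

theorem IsMasaCoordinates.isometry_toLp (hX : IsMasaCoordinates A Ω ι lam) (f : C(X, ℂ)) :
    hX.isometry (ContinuousMap.toLp 2 lam ℂ f) = ι f Ω :=
  LinearMap.extendOfNorm_eq (f := (ContinuousLinearMap.apply ℂ H Ω).toLinearMap.comp
      ι.toAlgHom.toLinearMap) (e := (ContinuousMap.toLp (E := ℂ) 2 lam ℂ).toLinearMap)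
      (ContinuousMap.toLp_denseRange ℂ lam ℂ (by simp))
      ⟨1, fun f => by rw [one_mul]; exact (hX.norm_eq f).le⟩ f

/-- The projection of `L²(M)` onto `L²(A)`, read as a function on `X`. -/
noncomputable def IsMasaCoordinates.toFun (hX : IsMasaCoordinates A Ω ι lam) :
    H →L[ℂ] Lp ℂ 2 lam :=
  ContinuousLinearMap.adjoint hX.isometry.toContinuousLinearMap

theorem IsMasaCoordinates.inner_toFun (hX : IsMasaCoordinates A Ω ι lam) (ξ : Lp ℂ 2 lam) (w : H) :
    ⟪ξ, hX.toFun w⟫_ℂ = ⟪hX.isometry ξ, w⟫_ℂ :=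
  ContinuousLinearMap.adjoint_inner_right hX.isometry.toContinuousLinearMap ξ w

theorem IsMasaCoordinates.inner_coord (hX : IsMasaCoordinates A Ω ι lam) (f : C(X, ℂ)) (w : H) :
    ⟪ι f Ω, w⟫_ℂ = ∫ t, star (f t) * hX.toFun w t ∂lam := by
  rw [← hX.isometry_toLp, ← hX.inner_toFun, L2.inner_def]
  refine integral_congr_ae ?_
  filter_upwards [f.coeFn_toLp (p := 2) (𝕜 := ℂ) lam] with t ht
  rw [ht, RCLike.inner_apply, mul_comm]
  rfl

theorem IsMasaCoordinates.integrable_toFun (hX : IsMasaCoordinates A Ω ι lam) (w : H) :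
    Integrable (hX.toFun w) lam :=
  (Lp.memLp (hX.toFun w)).integrable one_le_two

theorem IsMasaCoordinates.toFun_map (hX : IsMasaCoordinates A Ω ι lam) (f : C(X, ℂ)) (w : H) :
    hX.toFun (ι f w) =ᵐ[lam] fun t => f t * hX.toFun w t := by
  refine ae_eq_of_forall_integral_continuous_mul (hX.integrable_toFun _)
    (f.integrable_mul (hX.integrable_toFun _)) fun g => ?_
  have h1 := hX.inner_coord (star g) (ι f w)
  have h2 := hX.inner_coord (star f * star g) w
  rw [← inner_map_star] at h1
  rw [map_mul] at h2
  have h3 := h1.symm.trans h2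
  simpa [mul_assoc, mul_comm, mul_left_comm] using h3

/-- As `A` is abelian, `f · (aΩ) = a (f Ω)`. So multiplication by the function of `aΩ` has norm at
most `‖a‖` on the continuous functions in `L²`, and a multiplier is essentially bounded by its norm.
-/
theorem IsMasaCoordinates.enorm_toFun_le (hX : IsMasaCoordinates A Ω ι lam) (hA : IsMasa A M)
    {a : H →L[ℂ] H} (ha : a ∈ A) : ∀ᵐ t ∂lam, ‖hX.toFun (a Ω) t‖ₑ ≤ ‖a‖ₑ := by
  refine ae_enorm_le_of_forall_lintegral_continuous_mul (Lp.aestronglyMeasurable _)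
    enorm_ne_top fun f => ?_
  have h1 : ∫⁻ t, ‖f t * hX.toFun (a Ω) t‖ₑ ^ 2 ∂lam = ‖hX.toFun (ι f (a Ω))‖ₑ ^ 2 := by
    rw [enorm_sq_eq_lintegral]
    refine lintegral_congr_ae ?_
    filter_upwards [hX.toFun_map f (a Ω)] with t ht
    rw [ht]
  have h2 : ∫⁻ t, ‖f t‖ₑ ^ 2 ∂lam = ‖ContinuousMap.toLp (E := ℂ) 2 lam ℂ f‖ₑ ^ 2 := by
    rw [enorm_sq_eq_lintegral]
    refine lintegral_congr_ae ?_
    filter_upwards [f.coeFn_toLp (p := 2) (𝕜 := ℂ) lam] with t ht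
    rw [ht]
  rw [h1, h2, ← mul_pow]
  gcongr
  have h3 : ι f (a Ω) = a (ι f Ω) :=
    congrArg (fun T : H →L[ℂ] H => T Ω) (hA.comm _ (hX.mem f) _ ha)
  have h4 : ‖hX.toFun (ι f (a Ω))‖ ≤ ‖a‖ * ‖ContinuousMap.toLp (E := ℂ) 2 lam ℂ f‖ := by
    rw [← hX.norm_eq, h3]
    refine le_trans ?_ (a.le_opNorm _)
    refine (ContinuousLinearMap.le_opNorm _ _).trans (mul_le_of_le_one_left (norm_nonneg _) ?_)
    refine (ContinuousLinearMap.adjoint.norm_map _).trans_le ?_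
    exact hX.isometry.norm_toContinuousLinearMap_le
  rw [← ofReal_norm, ← ofReal_norm, ← ofReal_norm, ← ENNReal.ofReal_mul (norm_nonneg _)]
  exact ENNReal.ofReal_le_ofReal h4

theorem IsMasaCoordinates.norm_toFun_le (hX : IsMasaCoordinates A Ω ι lam) (hA : IsMasa A M)
    {a : H →L[ℂ] H} (ha : a ∈ A) : ∀ᵐ t ∂lam, ‖hX.toFun (a Ω) t‖ ≤ ‖a‖ := by
  filter_upwards [hX.enorm_toFun_le hA ha] with t ht
  exact enorm_le_iff_norm_le.1 ht

theorem IsMasaCoordinates.isFunctionOf_toFun (hX : IsMasaCoordinates A Ω ι lam) (hA : IsMasa A M)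
    {a : H →L[ℂ] H} (ha : a ∈ A) : IsFunctionOf Ω ι lam a (hX.toFun (a Ω)) := by
  refine ⟨memLp_top_of_bound (Lp.aestronglyMeasurable _) ‖a‖ (hX.norm_toFun_le hA ha),
    fun g h => ?_⟩
  have h3 : a (ι h Ω) = ι h (a Ω) :=
    congrArg (fun T : H →L[ℂ] H => T Ω) (hA.comm _ ha _ (hX.mem h))
  rw [h3, hX.inner_coord]
  refine integral_congr_ae ?_
  filter_upwards [hX.toFun_map h (a Ω)] with t ht
  rw [ht]
  ring

theorem IsFunctionOf.ae_eq {a : H →L[ℂ] H} {φ ψ : X → ℂ} (hφ : IsFunctionOf Ω ι lam a φ)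
    (hψ : IsFunctionOf Ω ι lam a ψ) : φ =ᵐ[lam] ψ := by
  refine ae_eq_of_forall_integral_continuous_mul (hφ.1.integrable le_top)
    (hψ.1.integrable le_top) fun f => ?_
  have h1 := (hφ.2 1 f).symm.trans (hψ.2 1 f)
  simpa [mul_comm] using h1

/-- Weak operator density enters here: a vector orthogonal to every `ι f Ω` is orthogonal to `aΩ`,
so `aΩ` lies in the double orthocomplement of the closed range. -/
theorem IsMasaCoordinates.apply_mem_range (hX : IsMasaCoordinates A Ω ι lam)
    {a : H →L[ℂ] H} (ha : a ∈ A) : ∃ ξ, hX.isometry ξ = a Ω := by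
  let S := LinearMap.range hX.isometry.toLinearMap
  have hS : IsClosed (S : Set H) := hX.isometry.isometry.isClosedEmbedding.isClosed_range
  have : CompleteSpace S := hS.completeSpace_coe
  suffices a Ω ∈ S from this
  rw [← Submodule.orthogonal_orthogonal S, Submodule.mem_orthogonal]
  intro v hv
  have hcl : IsClosed {T : H →WOT[ℂ] H | ⟪v, T Ω⟫_ℂ = 0} :=
    isClosed_eq (ContinuousLinearMapWOT.continuous_dual_apply Ω (innerSL ℂ v)) continuous_const
  refine closure_minimal ?_ hcl (hX.dense a ha)
  rintro _ ⟨f, rfl⟩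
  change ⟪v, ι f Ω⟫_ℂ = 0
  rw [← hX.isometry_toLp]
  exact inner_eq_zero_symm.1 ((Submodule.mem_orthogonal S v).1 hv _ (LinearMap.mem_range_self _ _))

/-- Extends `inner_coord` from `C(X)` to all of `A`. Since `aΩ` lies in the range of the isometry,
the pairing sees only the projection of `w`. -/
theorem IsMasaCoordinates.inner_apply (hX : IsMasaCoordinates A Ω ι lam)
    {a : H →L[ℂ] H} (ha : a ∈ A) (w : H) :
    ⟪w, a Ω⟫_ℂ = ∫ t, star (hX.toFun w t) * hX.toFun (a Ω) t ∂lam := by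
  obtain ⟨ξ, hξ⟩ := hX.apply_mem_range ha
  have h1 : hX.toFun (a Ω) = ξ := by
    refine ext_inner_left ℂ fun ζ => ?_
    rw [hX.inner_toFun, ← hξ, LinearIsometry.inner_map_map]
  have h2 : ⟪w, a Ω⟫_ℂ = ⟪hX.toFun w, ξ⟫_ℂ := by
    rw [← hξ, ← inner_conj_symm, ← hX.inner_toFun, inner_conj_symm]
  rw [h2, h1, L2.inner_def]
  refine integral_congr_ae (ae_of_all _ fun t => ?_)
  simp only [RCLike.inner_apply]
  rw [mul_comm]
  rfl

end MasaCoordinates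

/-! ### Bounded vectors and relative commutants -/

section StandardForm
variable {H : Type*} [NormedAddCommGroup H] [InnerProductSpace ℂ H] [CompleteSpace H]
  {A M : VonNeumannAlgebra H} {Ω : H}

theorem IsIIOneStandardForm.eq_zero_of_apply (hM : IsIIOneStandardForm M Ω) {x : H →L[ℂ] H}
    (hx : x ∈ M) (h : x Ω = 0) : x = 0 :=
  hM.faithful x hx (by rw [mul_apply_eq_comp, h, map_zero, inner_zero_right])

/-- The vector `Ω` is cyclic for the commutant of `M`. -/
theorem IsIIOneStandardForm.dense_commutant (hM : IsIIOneStandardForm M Ω) :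
    DenseRange ((ContinuousLinearMap.apply ℂ H Ω).toLinearMap.comp
      M.commutant.toStarSubalgebra.toSubalgebra.toSubmodule.subtype) := by
  set ev := (ContinuousLinearMap.apply ℂ H Ω).toLinearMap.comp
    M.commutant.toStarSubalgebra.toSubalgebra.toSubmodule.subtype
  let K := (LinearMap.range ev).topologicalClosure
  have : CompleteSpace K := (Submodule.isClosed_topologicalClosure _).completeSpace_coe
  -- The closure `K` of `M'Ω` is invariant under `M'`, so its projection lies in `M'' = M`. Its
  -- complement annihilates `Ω`, which separates `M`.
  have hKinv : ∀ y ∈ M.commutant, K ∈ Module.End.invtSubmodule (y : H →ₗ[ℂ] H) := by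
    intro y hy
    rw [Module.End.mem_invtSubmodule_iff_forall_mem_of_mem]
    intro v hv
    have : (K : Set H) ⊆ {v | y v ∈ K} := by
      refine closure_minimal ?_
        ((Submodule.isClosed_topologicalClosure _).preimage y.continuous)
      rintro _ ⟨m, rfl⟩
      exact subset_closure
        ⟨⟨y * m.1, mul_mem (S := VonNeumannAlgebra H) (s := M.commutant) hy m.2⟩, rfl⟩
    exact this hv
  have hp : K.starProjection ∈ M := by
    rw [VonNeumannAlgebra.IsStarProjection.mem_iff isStarProjection_starProjection]
    intro y hy
    rw [Submodule.range_starProjection]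
    exact hKinv y hy
  have hΩK : Ω ∈ K := subset_closure ⟨⟨1, one_mem M.commutant⟩, rfl⟩
  have hq : (1 : H →L[ℂ] H) - K.starProjection = 0 :=
    hM.eq_zero_of_apply (sub_mem (one_mem M) hp)
      (by simp [Submodule.starProjection_eq_self_iff.2 hΩK])
  intro v
  have : K.starProjection v = v :=
    (congrArg (fun t : H →L[ℂ] H => t v) (sub_eq_zero.1 hq)).symm
  exact (this ▸ Submodule.starProjection_apply_mem K v : v ∈ K)

/-- Bounded vectors of `L²(M)` come from `M`. -/
theorem IsIIOneStandardForm.exists_mem_apply_eq (hM : IsIIOneStandardForm M Ω) {v : H} {K : ℝ}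
    (h : ∀ m ∈ M.commutant, ‖m v‖ ≤ K * ‖m Ω‖) : ∃ a ∈ M, a Ω = v := by
  let ev := (ContinuousLinearMap.apply ℂ H Ω).toLinearMap.comp
    M.commutant.toStarSubalgebra.toSubalgebra.toSubmodule.subtype
  let fv := (ContinuousLinearMap.apply ℂ H v).toLinearMap.comp
    M.commutant.toStarSubalgebra.toSubalgebra.toSubmodule.subtype
  have hdense : DenseRange ev := hM.dense_commutant
  -- The operator `mΩ ↦ m v` on the dense subspace `M'Ω`. It intertwines the action of `M'`, so it
  -- belongs to `M''`.
  let a : H →L[ℂ] H := fv.extendOfNorm ev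
  have haev : ∀ m ∈ M.commutant, a (m Ω) = m v := fun m hm =>
    LinearMap.extendOfNorm_eq hdense ⟨K, fun n => h n.1 n.2⟩ ⟨m, hm⟩
  refine ⟨a, ?_, by simpa using haev 1 (one_mem _)⟩
  rw [← VonNeumannAlgebra.commutant_commutant M, VonNeumannAlgebra.mem_commutant_iff]
  intro n hn
  ext w
  refine hdense.induction_on (p := fun w => (n * a) w = (a * n) w) w
    (isClosed_eq (by fun_prop) (by fun_prop)) fun m => ?_
  change n (a (m.1 Ω)) = a ((n * m.1) Ω)
  rw [haev m.1 m.2, haev _ (mul_mem hn m.2)]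
  rfl

/-- A masa is its own relative commutant. -/
theorem IsMasa.mem_of_commute (hA : IsMasa A M) {a : H →L[ℂ] H} (ha : a ∈ M)
    (h : ∀ b ∈ A, a * b = b * a) : a ∈ A := by
  -- For self-adjoint `s` the star algebra generated by `A` and `s` is abelian, and maximality
  -- applies to it.
  have key : ∀ s ∈ M, star s = s → (∀ b ∈ A, s * b = b * s) → s ∈ A := by
    intro s hs hss hsb
    let S : Set (H →L[ℂ] H) := {t | t ∈ A ∨ t = s}
    have hcomm : ∀ x ∈ S, ∀ y ∈ S, x * y = y * x := by
      rintro x (hx | rfl) y (hy | rfl)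
      · exact hA.comm x hx y hy
      · exact (hsb x hx).symm
      · exact hsb y hy
      · rfl
    have hstar : ∀ x ∈ S, star x ∈ S := by
      rintro x (hx | rfl)
      · exact Or.inl (star_mem hx)
      · exact Or.inr hss
    have hc := StarAlgebra.isMulCommutative_adjoin (R := ℂ) hcomm
      fun x hx y hy => hcomm x hx _ (hstar y hy)
    refine hA.maximal (StarAlgebra.adjoin ℂ S) (fun b hb => ?_) (fun x hx y hy => ?_)
      (fun x hx => StarAlgebra.subset_adjoin ℂ S (Or.inl hx)) s
      (StarAlgebra.subset_adjoin ℂ S (Or.inr rfl))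
    · have : StarAlgebra.adjoin ℂ S ≤ M.toStarSubalgebra := by
        refine StarAlgebra.adjoin_le ?_
        rintro x (hx | rfl)
        · exact hA.le hx
        · exact hs
      exact this hb
    · exact congrArg Subtype.val (hc.is_comm.comm (⟨x, hx⟩ : StarAlgebra.adjoin ℂ S) ⟨y, hy⟩)
  have h' : ∀ b ∈ A, star a * b = b * star a := by
    intro b hb
    have := congrArg star (h _ (star_mem hb))
    simpa using this.symm
  have h1 : a + star a ∈ A := by
    refine key _ (add_mem ha (star_mem ha)) (by rw [star_add, star_star, add_comm]) fun b hb => ?_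
    rw [add_mul, mul_add, h b hb, h' b hb]
  have h2 : Complex.I • (a - star a) ∈ A := by
    refine key _ ?_ ?_ fun b hb => ?_
    · exact M.toStarSubalgebra.smul_mem (sub_mem ha (star_mem ha)) _
    · rw [star_smul, star_sub, star_star, ← neg_sub a, smul_neg]
      simp
    · rw [smul_mul_assoc, mul_smul_comm, sub_mul, mul_sub, h b hb, h' b hb]
  -- The general case is reduced to the self-adjoint elements `a + a*` and `i (a - a*)`.
  have h3 : a = (1 / 2 : ℂ) • (a + star a) + (-Complex.I / 2) • (Complex.I • (a - star a)) := by
    rw [smul_smul]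
    have : -Complex.I / 2 * Complex.I = 1 / 2 := by
      rw [div_mul_eq_mul_div, neg_mul, Complex.I_mul_I, neg_neg]
    rw [this]
    module
  rw [h3]
  exact add_mem (A.toStarSubalgebra.smul_mem h1 _) (A.toStarSubalgebra.smul_mem h2 _)

/-- Commuting with the dense subalgebra `C(X)` is enough: for fixed `v` and `w`, the identity `⟪w, a
b v⟫ = ⟪w, b a v⟫` is a weak operator closed condition on `b`. -/
theorem IsMasaCoordinates.mem_of_commute {X : Type*} [TopologicalSpace X] [CompactSpace X]
    [MeasurableSpace X] [BorelSpace X] [T2Space X] [SecondCountableTopology X]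
    {ι : C(X, ℂ) →⋆ₐ[ℂ] (H →L[ℂ] H)} {lam : Measure X}
    (hX : IsMasaCoordinates A Ω ι lam) (hA : IsMasa A M) {a : H →L[ℂ] H} (ha : a ∈ M)
    (h : ∀ f, a * ι f = ι f * a) : a ∈ A := by
  refine hA.mem_of_commute ha fun b hb => ContinuousLinearMap.ext fun v => ?_
  refine ext_inner_left ℂ fun w => ?_
  have hcl : IsClosed {T : H →WOT[ℂ] H | ⟪star a w, T v⟫_ℂ = ⟪w, T (a v)⟫_ℂ} :=
    isClosed_eq (ContinuousLinearMapWOT.continuous_dual_apply v (innerSL ℂ (star a w)))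
      (ContinuousLinearMapWOT.continuous_dual_apply (a v) (innerSL ℂ w))
  have := closure_minimal (by
    rintro _ ⟨f, rfl⟩
    change ⟪star a w, ι f v⟫_ℂ = ⟪w, ι f (a v)⟫_ℂ
    rw [inner_star']
    exact congrArg (fun T : H →L[ℂ] H => ⟪w, T v⟫_ℂ) (h f)) hcl (hX.dense b hb)
  change ⟪star a w, b v⟫_ℂ = ⟪w, b (a v)⟫_ℂ at this
  rwa [inner_star'] at this

end StandardForm

/-! ### Averaging over conjugations by unitaries of `C(X)` -/

/-- Countably many unitaries of `C(X)` separate the points of `X`. -/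
theorem exists_separating_unitaries (X : Type*) [TopologicalSpace X] [CompactSpace X] [T2Space X]
    [SecondCountableTopology X] [Nonempty X] :
    ∃ u : ℕ → C(X, ℂ), (∀ j t, ‖u j t‖ = 1) ∧ ∀ s t, s ≠ t → ∃ j, u j s ≠ u j t := by
  let _ : MetricSpace X := TopologicalSpace.metrizableSpaceMetric X
  have hne : ∀ r : ℝ, 1 - (r : ℂ) * Complex.I ≠ 0 := fun r h => by
    have := congrArg Complex.re h
    simp at this
  -- The Cayley transform `r ↦ (1 + ir)/(1 - ir)`, injective from the real line to the unit circle,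
  -- applied to the distance from the `j`-th point of a dense sequence.
  let u : ℕ → C(X, ℂ) := fun j =>
    ⟨fun t => (1 + (dist t (TopologicalSpace.denseSeq X j) : ℂ) * Complex.I)
      / (1 - (dist t (TopologicalSpace.denseSeq X j) : ℂ) * Complex.I),
      Continuous.div (by fun_prop) (by fun_prop) fun t => hne _⟩
  refine ⟨u, fun j t => ?_, fun s t hst => ?_⟩
  · change ‖(1 + (dist t (TopologicalSpace.denseSeq X j) : ℂ) * Complex.I)
      / (1 - (dist t (TopologicalSpace.denseSeq X j) : ℂ) * Complex.I)‖ = 1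
    set r : ℝ := dist t (TopologicalSpace.denseSeq X j)
    have : (1 + (r : ℂ) * Complex.I) = star (1 - (r : ℂ) * Complex.I) := by simp
    rw [norm_div, this, norm_star, div_self (norm_ne_zero_iff.2 (hne r))]
  · have hpos : 0 < dist s t := dist_pos.2 hst
    -- If `u j` agreed at `s` and `t`, both would be at the same distance, less than `dist s t / 2`,
    -- from the `j`-th point.
    obtain ⟨j, hj⟩ := (TopologicalSpace.denseRange_denseSeq X).exists_dist_lt s
      (show 0 < dist s t / 2 by positivity)
    refine ⟨j, fun h => ?_⟩
    change (1 + (dist s (TopologicalSpace.denseSeq X j) : ℂ) * Complex.I)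
      / (1 - (dist s (TopologicalSpace.denseSeq X j) : ℂ) * Complex.I)
      = (1 + (dist t (TopologicalSpace.denseSeq X j) : ℂ) * Complex.I)
      / (1 - (dist t (TopologicalSpace.denseSeq X j) : ℂ) * Complex.I) at h
    rw [div_eq_div_iff (hne _) (hne _)] at h
    have h2 := congrArg Complex.im h
    simp at h2
    have h3 := dist_triangle s (TopologicalSpace.denseSeq X j) t
    rw [dist_comm (TopologicalSpace.denseSeq X j) t] at h3
    linarith

/-- The functions on `X × X` that multiply the averages `conjAverage`. -/
noncomputable def conjKernel {X : Type*} [TopologicalSpace X] (u : ℕ → C(X, ℂ)) :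
    ℕ → X × X → ℂ
  | 0 => fun _ => 1
  | n + 1 => fun p =>
      (1 / 2 : ℂ) * (1 + u n.unpair.1 p.1 * star (u n.unpair.1 p.2)) * conjKernel u n p

/-- Successive averages of `x` and its conjugates by the unitaries `u j`, each of which is used
infinitely often. -/
noncomputable def conjAverage {H : Type*} [NormedAddCommGroup H] [InnerProductSpace ℂ H]
    [CompleteSpace H] {X : Type*} [TopologicalSpace X] (ι : C(X, ℂ) →⋆ₐ[ℂ] (H →L[ℂ] H))
    (u : ℕ → C(X, ℂ)) (x : H →L[ℂ] H) : ℕ → H →L[ℂ] H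
  | 0 => x
  | n + 1 => (1 / 2 : ℂ) • (conjAverage ι u x n
      + ι (u n.unpair.1) * conjAverage ι u x n * ι (star (u n.unpair.1)))

section Kernel
variable {X : Type*} [TopologicalSpace X] {u : ℕ → C(X, ℂ)}

theorem norm_conjKernel_succ (u : ℕ → C(X, ℂ)) (n : ℕ) (p : X × X) :
    ‖conjKernel u (n + 1) p‖ = ‖(1 / 2 : ℂ) * (1 + u n.unpair.1 p.1 * star (u n.unpair.1 p.2))‖
      * ‖conjKernel u n p‖ :=
  norm_mul _ _

theorem norm_half_one_add_le {z : ℂ} (hz : ‖z‖ = 1) : ‖(1 / 2 : ℂ) * (1 + z)‖ ≤ 1 := by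
  have := norm_add_le (1 : ℂ) z
  rw [hz, norm_one] at this
  rw [norm_mul]
  norm_num
  linarith

theorem norm_half_one_add_lt {z : ℂ} (hz : ‖z‖ = 1) (hz1 : z ≠ 1) :
    ‖(1 / 2 : ℂ) * (1 + z)‖ < 1 := by
  have h1 : z.re * z.re + z.im * z.im = 1 := by
    have := Complex.normSq_eq_norm_sq z
    rw [hz, Complex.normSq_apply] at this
    simpa using this
  have h2 : z.re < 1 := by
    by_contra! h
    have h3 : z.im = 0 := by nlinarith [sq_nonneg z.im]
    have h4 : z.re = 1 := by nlinarith
    exact hz1 (Complex.ext h4 h3)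
  have h5 : ‖1 + z‖ ^ 2 < 2 ^ 2 := by
    rw [← Complex.normSq_eq_norm_sq, Complex.normSq_apply]
    simp only [Complex.add_re, Complex.add_im, Complex.one_re, Complex.one_im]
    nlinarith
  have h6 := (sq_lt_sq₀ (norm_nonneg _) zero_le_two).1 h5
  rw [norm_mul]
  norm_num
  linarith

theorem norm_mul_star_eq_one (hu : ∀ j t, ‖u j t‖ = 1) (j : ℕ) (s t : X) :
    ‖u j s * star (u j t)‖ = 1 := by
  rw [norm_mul, norm_star, hu, hu, one_mul]

theorem antitone_norm_conjKernel (hu : ∀ j t, ‖u j t‖ = 1) (p : X × X) :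
    Antitone fun n => ‖conjKernel u n p‖ :=
  antitone_nat_of_succ_le fun n => by
    rw [norm_conjKernel_succ]
    exact mul_le_of_le_one_left (norm_nonneg _)
      (norm_half_one_add_le (norm_mul_star_eq_one hu _ _ _))

theorem norm_conjKernel_le_one (hu : ∀ j t, ‖u j t‖ = 1) (n : ℕ) (p : X × X) :
    ‖conjKernel u n p‖ ≤ 1 :=
  (antitone_norm_conjKernel hu p n.zero_le).trans norm_one.le

theorem conjKernel_diag (hu : ∀ j t, ‖u j t‖ = 1) (n : ℕ) (t : X) :
    conjKernel u n (t, t) = 1 := by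
  induction n with
  | zero => rfl
  | succ n ih =>
    change (1 / 2 : ℂ) * (1 + u n.unpair.1 t * star (u n.unpair.1 t)) * conjKernel u n (t, t) = 1
    have : u n.unpair.1 t * star (u n.unpair.1 t) = 1 := by
      have := Complex.mul_conj (u n.unpair.1 t)
      rw [Complex.normSq_eq_norm_sq, hu] at this
      simpa using this
    rw [ih, this]
    norm_num

/-- Off the diagonal the absolute values decrease to some `L`. A unitary separating the two points
recurs infinitely often, each time multiplying by the same `r < 1`, so `L = r L` and `L = 0`. -/
theorem tendsto_conjKernel (hu : ∀ j t, ‖u j t‖ = 1) (hsep : ∀ s t, s ≠ t → ∃ j, u j s ≠ u j t)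
    (p : X × X) :
    Tendsto (fun n => conjKernel u n p) atTop (𝓝 ((Set.diagonal X).indicator 1 p)) := by
  obtain ⟨s, t⟩ := p
  by_cases hst : s = t
  · subst hst
    simp only [conjKernel_diag hu]
    simp
  obtain ⟨j, hj⟩ := hsep s t hst
  have hz : u j s * star (u j t) ≠ 1 := fun h => hj <| by
    have h2 : star (u j t) * u j t = 1 := by
      have := Complex.mul_conj (u j t)
      rw [Complex.normSq_eq_norm_sq, hu, mul_comm] at this
      simpa using this
    calc u j s = u j s * (star (u j t) * u j t) := by rw [h2, mul_one]
      _ = u j t := by rw [← mul_assoc, h, one_mul]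
  have hr := norm_half_one_add_lt (norm_mul_star_eq_one hu j s t) hz
  obtain ⟨L, hL⟩ : ∃ L, Tendsto (fun n => ‖conjKernel u n (s, t)‖) atTop (𝓝 L) :=
    ⟨_, tendsto_atTop_ciInf (antitone_norm_conjKernel hu _) ⟨0, by rintro _ ⟨n, rfl⟩; positivity⟩⟩
  -- The indices `Nat.pair j i` are the steps at which `u j` is applied.
  have hpair : Tendsto (fun i => Nat.pair j i) atTop atTop :=
    tendsto_atTop_mono (fun i => Nat.right_le_pair j i) tendsto_id
  have h1 := hL.comp ((tendsto_add_atTop_nat 1).comp hpair)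
  have h2 := (hL.comp hpair).const_mul ‖(1 / 2 : ℂ) * (1 + u j s * star (u j t))‖
  have h3 := tendsto_nhds_unique h1 (h2.congr fun i => by
    have := norm_conjKernel_succ u (Nat.pair j i) (s, t)
    rw [Nat.unpair_pair] at this
    exact this.symm)
  have hL0 : L = 0 := by
    have : (1 - ‖(1 / 2 : ℂ) * (1 + u j s * star (u j t))‖) * L = 0 := by
      rw [sub_mul, one_mul, ← h3, sub_self]
    exact (mul_eq_zero.1 this).resolve_left (sub_pos.2 hr).ne'
  rw [Set.indicator_of_notMem (show (s, t) ∉ Set.diagonal X from hst)]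
  exact tendsto_zero_iff_norm_tendsto_zero.2 (hL0 ▸ hL)

end Kernel

theorem conjAverage_mem {H : Type*} [NormedAddCommGroup H] [InnerProductSpace ℂ H] [CompleteSpace H]
    {M : VonNeumannAlgebra H} {X : Type*} [TopologicalSpace X] {ι : C(X, ℂ) →⋆ₐ[ℂ] (H →L[ℂ] H)}
    {u : ℕ → C(X, ℂ)} {x : H →L[ℂ] H} (hι : ∀ f, ι f ∈ M) (hx : x ∈ M) (n : ℕ) : conjAverage ι u x n ∈ M := by
  induction n with
  | zero => exact hx
  | succ n ih =>
    exact M.toStarSubalgebra.smul_mem (add_mem ih (mul_mem (mul_mem (hι _) ih) (hι _))) _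

section Average
variable {H : Type*} [NormedAddCommGroup H] [InnerProductSpace ℂ H] [CompleteSpace H]
  {A M : VonNeumannAlgebra H} {Ω : H}
  {X : Type*} [TopologicalSpace X]
  {ι : C(X, ℂ) →⋆ₐ[ℂ] (H →L[ℂ] H)} {u : ℕ → C(X, ℂ)} {x : H →L[ℂ] H}

theorem norm_conjAverage_le [CompactSpace X] (hu : ∀ j t, ‖u j t‖ = 1) (n : ℕ) :
    ‖conjAverage ι u x n‖ ≤ ‖x‖ := by
  induction n with
  | zero => exact le_rfl
  | succ n ih =>
    have h1 : ‖ι (u n.unpair.1)‖ ≤ 1 :=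
      (NonUnitalStarAlgHom.norm_apply_le ι _).trans
        ((ContinuousMap.norm_le _ zero_le_one).2 fun t => (hu _ t).le)
    have h2 : ‖ι (star (u n.unpair.1))‖ ≤ 1 := by rwa [map_star, norm_star]
    calc ‖conjAverage ι u x (n + 1)‖
        ≤ ‖(1 / 2 : ℂ)‖ * ‖conjAverage ι u x n
          + ι (u n.unpair.1) * conjAverage ι u x n * ι (star (u n.unpair.1))‖ := norm_smul_le _ _
      _ ≤ ‖(1 / 2 : ℂ)‖ * (‖x‖ + 1 * ‖x‖ * 1) := by
        gcongr
        refine (norm_add_le _ _).trans (add_le_add ih ?_)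
        refine (norm_mul_le _ _).trans ?_
        gcongr
        refine (norm_mul_le _ _).trans ?_
        gcongr
      _ = ‖x‖ := by norm_num; ring

/-- By the trace property and commutativity of `A`, `τ(c* f z f*) = τ(f* c* f z) = τ(c* z)`:
conjugation by a unitary of `A` does not change inner products with `A`. -/
theorem inner_conjAverage (hM : IsIIOneStandardForm M Ω) (hA : IsMasa A M) (hι : ∀ f, ι f ∈ A)
    (hu : ∀ j t, ‖u j t‖ = 1) (hx : x ∈ M) {c : H →L[ℂ] H} (hc : c ∈ A) (n : ℕ) :
    ⟪c Ω, conjAverage ι u x n Ω⟫_ℂ = ⟪c Ω, x Ω⟫_ℂ := by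
  induction n with
  | zero => rfl
  | succ n ih =>
    set f := u n.unpair.1 with hf
    set z := conjAverage ι u x n with hz
    have hzM : z ∈ M := conjAverage_mem (fun f => hA.le (hι f)) hx n
    have hff : ι (star f) * ι f = 1 := by
      rw [← map_mul, ← map_one ι]
      congr 1
      ext t
      have := Complex.mul_conj (f t)
      rw [Complex.normSq_eq_norm_sq, hu, mul_comm] at this
      simpa using this
    have h1 : ⟪c Ω, (ι f * z * ι (star f)) Ω⟫_ℂ = ⟪c Ω, z Ω⟫_ℂ := by
      rw [← inner_star, ← inner_star c]
      have hcM := hA.le (star_mem hc : star c ∈ A)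
      have h2 := hM.trace_comm (star c * ι f * z)
        (mul_mem (mul_mem hcM (hA.le (hι _))) hzM) (ι (star f)) (hA.le (hι _))
      have h3 : ι (star f) * (star c * ι f * z) = star c * z := by
        rw [hA.comm _ (star_mem hc) _ (hι f), ← mul_assoc, ← mul_assoc, hff, one_mul]
      rw [h3] at h2
      simpa using h2
    change ⟪c Ω, (1 / 2 : ℂ) • (z Ω + (ι f * z * ι (star f)) Ω)⟫_ℂ = _
    rw [inner_smul_right, inner_add_right, h1, ih]
    ring

theorem ae_conjAverage {M : VonNeumannAlgebra H} [MeasurableSpace X]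
    {η : Measure (X × X)} {m : X × X → ℕ∞}
    (W : H ≃ₗᵢ[ℂ] directIntegral η m) (hW : ∀ x ∈ M, ∀ f g : C(X, ℂ),
      ∀ᵐ p ∂η, (W ((ι f * x * ι g) Ω)).1 p = (f p.1 * g p.2) • (W (x Ω)).1 p)
    (hι : ∀ f, ι f ∈ M) (hx : x ∈ M) (n : ℕ) :
    ∀ᵐ p ∂η, (W (conjAverage ι u x n Ω)).1 p = conjKernel u n p • (W (x Ω)).1 p := by
  induction n with
  | zero => exact ae_of_all _ fun p => (one_smul ℂ _).symm
  | succ n ih =>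
    set f := u n.unpair.1 with hf
    set z := conjAverage ι u x n with hz
    have h1 : (W (conjAverage ι u x (n + 1) Ω)).1
        = (1 / 2 : ℂ) • ((W (z Ω)).1 + (W ((ι f * z * ι (star f)) Ω)).1) := by
      change (W ((1 / 2 : ℂ) • (z Ω + (ι f * z * ι (star f)) Ω))).1 = _
      rw [map_smul, map_add]
      rfl
    rw [h1]
    filter_upwards [ih, hW z (conjAverage_mem hι hx n) f (star f),
      Lp.coeFn_smul (1 / 2 : ℂ) ((W (z Ω)).1 + (W ((ι f * z * ι (star f)) Ω)).1),
      Lp.coeFn_add (W (z Ω)).1 (W ((ι f * z * ι (star f)) Ω)).1] with p h2 h3 h4 h5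
    rw [h4, Pi.smul_apply, h5, Pi.add_apply, h3, h2]
    change _ = ((1 / 2 : ℂ) * (1 + f p.1 * star (f p.2)) * conjKernel u n p) • _
    rw [ContinuousMap.star_apply]
    module

end Average

/-! ### The diagonal part and the integral kernel -/

theorem inner_directIntegral {H : Type*} [NormedAddCommGroup H] [InnerProductSpace ℂ H]
    {Y : Type*} [MeasurableSpace Y] {η : Measure Y} {m : Y → ℕ∞}
    (W : H ≃ₗᵢ[ℂ] directIntegral η m) (v w : H) :
    ⟪v, w⟫_ℂ = ∫ p, ⟪(W v).1 p, (W w).1 p⟫_ℂ ∂η := by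
  rw [← W.inner_map_map, Submodule.coe_inner, L2.inner_def]

section BimoduleDecomposition
variable {H : Type*} [NormedAddCommGroup H] [InnerProductSpace ℂ H] [CompleteSpace H]
  {A M : VonNeumannAlgebra H} {Ω : H}
  {X : Type*} [TopologicalSpace X] [CompactSpace X] [T2Space X] [SecondCountableTopology X]
  [MeasurableSpace X] [BorelSpace X] {ι : C(X, ℂ) →⋆ₐ[ℂ] (H →L[ℂ] H)} {lam : Measure X}
  {η : Measure (X × X)} {m : X × X → ℕ∞}

/-- An element of `M` orthogonal to `A` has no diagonal part in the direct integral
decomposition. -/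
theorem ae_eq_zero_of_mem_diagonal (hM : IsIIOneStandardForm M Ω) (hA : IsMasa A M)
    (hX : IsMasaCoordinates A Ω ι lam) (W : H ≃ₗᵢ[ℂ] directIntegral η m)
    (hW : ∀ x ∈ M, ∀ f g : C(X, ℂ),
      ∀ᵐ p ∂η, (W ((ι f * x * ι g) Ω)).1 p = (f p.1 * g p.2) • (W (x Ω)).1 p)
    {x : H →L[ℂ] H} (hx : x ∈ M) (hx0 : ∀ c ∈ A, ⟪c Ω, x Ω⟫_ℂ = 0) :
    ∀ᵐ p ∂η, p ∈ Set.diagonal X → (W (x Ω)).1 p = 0 := by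
  rcases isEmpty_or_nonempty X with hempty | hne
  · exact ae_of_all _ fun p => isEmptyElim p.1
  obtain ⟨u, hu, hsep⟩ := exists_separating_unitaries X
  have hιM : ∀ f, ι f ∈ M := fun f => hA.le (hX.mem f)
  set F := (W (x Ω)).1 with hF
  have hΔ : MeasurableSet (Set.diagonal X) := isClosed_diagonal.measurableSet
  have hGL := (Lp.memLp F).indicator hΔ
  have hGF := hGL.coeFn_toLp
  set G := hGL.toLp _
  have hG : G ∈ directIntegral η m := by
    change ∀ᵐ p ∂η, ∀ i : ℕ, m p ≤ i → G p i = 0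
    have h1 : ∀ᵐ p ∂η, ∀ i : ℕ, m p ≤ i → F p i = 0 := (W (x Ω)).2
    filter_upwards [hGF, h1] with p h2 h3 i hi
    rw [h2]
    by_cases hp : p ∈ Set.diagonal X
    · rw [Set.indicator_of_mem hp]
      exact h3 i hi
    · rw [Set.indicator_of_notMem hp]
      rfl
  set v := W.symm ⟨G, hG⟩ with hv
  have hWv : (W v).1 = G := by rw [hv, W.apply_symm_apply]
  -- The averages converge weakly to the diagonal part `v`, by dominated convergence in the direct
  -- integral.
  have hlim : ∀ w, Tendsto (fun n => ⟪w, conjAverage ι u x n Ω⟫_ℂ) atTop (𝓝 ⟪w, v⟫_ℂ) := by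
    intro w
    simp only [inner_directIntegral W]
    refine tendsto_integral_of_dominated_convergence (fun p => ‖⟪(W w).1 p, F p⟫_ℂ‖)
      (fun n => (L2.integrable_inner _ _).aestronglyMeasurable)
      (L2.integrable_inner (W w).1 F).norm (fun n => ?_) ?_
    · filter_upwards [ae_conjAverage (u := u) W hW hιM hx n] with p hp
      rw [hp, inner_smul_right, norm_mul]
      exact mul_le_of_le_one_left (norm_nonneg _) (norm_conjKernel_le_one hu n p)
    · have h1 : ∀ᵐ p ∂η, ∀ n, (W (conjAverage ι u x n Ω)).1 p = conjKernel u n p • F p :=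
        ae_all_iff.2 fun n => ae_conjAverage W hW hιM hx n
      filter_upwards [h1, hGF] with p h2 h3
      rw [hWv, h3]
      simp only [h2, inner_smul_right]
      have h4 := (tendsto_conjKernel hu hsep p).mul_const ⟪(W w).1 p, F p⟫_ℂ
      convert h4 using 2
      by_cases hp : p ∈ Set.diagonal X <;> simp [hp]
  -- The averages `x_n` satisfy `‖x_n‖ ≤ ‖x‖` and commute with `t ∈ M'`. So `‖t v‖²` is the limit of
  -- `⟪t v, x_n t Ω⟫`, which is at most `‖t v‖ ‖x‖ ‖t Ω‖` in absolute value.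
  obtain ⟨a, haM, hav⟩ : ∃ a ∈ M, a Ω = v := by
    refine hM.exists_mem_apply_eq (K := ‖x‖) fun t ht => ?_
    have h1 : ‖⟪star t (t v), v⟫_ℂ‖ ≤ ‖t v‖ * (‖x‖ * ‖t Ω‖) := by
      refine le_of_tendsto' (hlim _).norm fun n => ?_
      have h2 : t (conjAverage ι u x n Ω) = conjAverage ι u x n (t Ω) :=
        (congrArg (fun T : H →L[ℂ] H => T Ω) (VonNeumannAlgebra.mem_commutant_iff.1 ht _
          (conjAverage_mem hιM hx n))).symm
      rw [inner_star', h2]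
      refine (norm_inner_le_norm _ _).trans ?_
      gcongr
      refine (ContinuousLinearMap.le_opNorm _ _).trans ?_
      gcongr
      exact norm_conjAverage_le hu n
    rw [inner_star', inner_self_eq_norm_sq_to_K] at h1
    rcases eq_or_lt_of_le (norm_nonneg (t v)) with h0 | h0
    · rw [← h0]
      positivity
    · refine le_of_mul_le_mul_left ?_ h0
      simpa [sq] using h1
  -- On the diagonal the left and right actions of `f` agree, and `aΩ` lives there.
  have hcomm : ∀ f, a * ι f = ι f * a := by
    intro f
    refine sub_eq_zero.1 (hM.eq_zero_of_apply
      (sub_mem (mul_mem haM (hιM f)) (mul_mem (hιM f) haM)) ?_)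
    rw [sub_apply, sub_eq_zero]
    refine W.injective (Subtype.ext (Lp.ext ?_))
    have h1 := hW a haM 1 f
    have h2 := hW a haM f 1
    rw [map_one, one_mul] at h1
    rw [map_one, mul_one] at h2
    rw [hav, hWv] at h1 h2
    filter_upwards [h1, h2, hGF] with p h3 h4 h5
    rw [h3, h4, h5]
    by_cases hp : p ∈ Set.diagonal X
    · have : p.1 = p.2 := hp
      simp [this]
    · simp [hp]
  have haA := hX.mem_of_commute hA haM hcomm
  -- `v` lies in `L²(A)`, yet as a weak limit of vectors orthogonal to `L²(A)` it is also orthogonal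
  -- to it.
  have hv0 : v = 0 := by
    refine eq_of_mem_masaL2 (A := A) (Ω := Ω) (hav ▸ apply_mem_masaL2 haA) (zero_mem _)
      fun c hc => ?_
    have h1 := hlim (c Ω)
    simp only [inner_conjAverage hM hA hX.mem hu hx hc, hx0 c hc] at h1
    rw [inner_zero_right]
    exact tendsto_nhds_unique h1 tendsto_const_nhds
  have h0 : G = 0 := by
    rw [← hWv, hv0, map_zero]
    rfl
  rw [h0] at hGF
  filter_upwards [hGF, Lp.coeFn_zero (lp (fun _ : ℕ => ℂ) 2) 2 η] with p h1 h2 hp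
  rw [h2, Set.indicator_of_mem hp] at h1
  exact h1.symm

/-- If the left-right measure is absolutely continuous with respect to `lam ⊗ lam`, the coefficient
`f ⊗ g ↦ ⟪y Ω, f x g Ω⟫` of an element `x` orthogonal to `A` has a density in `L¹(lam ⊗ lam)`. -/
theorem exists_bimodule_density [IsProbabilityMeasure lam] [IsFiniteMeasure η]
    (hM : IsIIOneStandardForm M Ω) (hA : IsMasa A M)
    (hX : IsMasaCoordinates A Ω ι lam) (W : H ≃ₗᵢ[ℂ] directIntegral η m)
    (hW : ∀ x ∈ M, ∀ f g : C(X, ℂ),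
      ∀ᵐ p ∂η, (W ((ι f * x * ι g) Ω)).1 p = (f p.1 * g p.2) • (W (x Ω)).1 p)
    (hac : η.restrict (Set.diagonal X)ᶜ ≪ lam.prod lam)
    {x : H →L[ℂ] H} (hx : x ∈ M) (hx0 : ∀ c ∈ A, ⟪c Ω, x Ω⟫_ℂ = 0) (w : H) :
    ∃ k : X × X → ℂ, Integrable k (lam.prod lam) ∧
      ∀ f g : C(X, ℂ), ⟪w, (ι f * x * ι g) Ω⟫_ℂ = ∫ p, f p.1 * g p.2 * k p ∂lam.prod lam := by
  set ρ := (η.restrict (Set.diagonal X)ᶜ).rnDeriv (lam.prod lam)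
  let B : X × X → ℂ := fun p => ⟪(W w).1 p, (W (x Ω)).1 p⟫_ℂ
  have hB : Integrable B η := L2.integrable_inner _ _
  -- The kernel is the fibrewise inner product times the density of the off-diagonal part of `η`.
  refine ⟨fun p => (ρ p).toReal • B p, (integrable_rnDeriv_smul_iff hac).2 hB.restrict,
    fun f g => ?_⟩
  have hΔ : MeasurableSet (Set.diagonal X) := isClosed_diagonal.measurableSet
  have h1 : ⟪w, (ι f * x * ι g) Ω⟫_ℂ = ∫ p, f p.1 * g p.2 * B p ∂η := by
    rw [inner_directIntegral W]
    refine integral_congr_ae ?_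
    filter_upwards [hW x hx f g] with p hp
    rw [hp, inner_smul_right]
  have h2 : ∫ p, f p.1 * g p.2 * B p ∂η
      = ∫ p, f p.1 * g p.2 * B p ∂η.restrict (Set.diagonal X)ᶜ := by
    rw [← integral_indicator hΔ.compl]
    refine integral_congr_ae ?_
    filter_upwards [ae_eq_zero_of_mem_diagonal hM hA hX W hW hx hx0] with p hp
    by_cases hd : p ∈ Set.diagonal X
    · simp [B, hp hd, hd]
    · simp [hd]
  rw [h1, h2, ← integral_rnDeriv_smul hac]
  refine integral_congr_ae (ae_of_all _ fun p => ?_)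
  exact (mul_smul_comm _ _ _).symm

/-- In the situation of `exists_bimodule_density`, `E_A(x u y*)` is the function
`t ↦ ∫ u(s) k(t, s)`. -/
theorem toFun_masaCondExp_ae_eq [IsProbabilityMeasure lam] (hM : IsIIOneStandardForm M Ω)
    (hA : IsMasa A M) (hX : IsMasaCoordinates A Ω ι lam) {x y : H →L[ℂ] H} (hx : x ∈ M)
    (hy : y ∈ M) {k : X × X → ℂ} (hk : Integrable k (lam.prod lam))
    (hkxy : ∀ f g : C(X, ℂ),
      ⟪y Ω, (ι f * x * ι g) Ω⟫_ℂ = ∫ p, f p.1 * g p.2 * k p ∂lam.prod lam)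
    {u : H →L[ℂ] H} (hu : u ∈ A) (hz : x * u * star y ∈ M) :
    hX.toFun (masaCondExp hM hA (x * u * star y) hz Ω) =ᵐ[lam]
      fun t => ∫ s, k (t, s) * hX.toFun (u Ω) s ∂lam := by
  have hψm := Lp.aestronglyMeasurable (hX.toFun (u Ω))
  have hψb := hX.norm_toFun_le hA hu
  have hkψ : Integrable (fun p : X × X => k p * hX.toFun (u Ω) p.2) (lam.prod lam) :=
    hk.mul_bdd (c := ‖u‖) hψm.comp_snd (Measure.quasiMeasurePreserving_snd.ae hψb)
  refine ae_eq_of_forall_integral_continuous_mul (hX.integrable_toFun _)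
    hkψ.integral_prod_left fun f => ?_
  have hmul : ∀ (g : X × X → ℂ), Integrable g (lam.prod lam) →
      Integrable (fun p => f p.1 * g p) (lam.prod lam) := fun g hg =>
    hg.bdd_mul (c := ‖f‖) (f.continuous.comp continuous_fst).aestronglyMeasurable
      (ae_of_all _ fun p => f.norm_coe_le_norm _)
  have e1 : ∫ t, f t * hX.toFun (masaCondExp hM hA (x * u * star y) hz Ω) t ∂lam
      = ⟪Ω, (ι f * (x * u * star y)) Ω⟫_ℂ := by
    rw [← trace_mul_masaCondExp hM hA hz (hX.mem f), mul_apply_eq_comp, ← inner_map_star,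
      hX.inner_coord]
    simp
  -- The trace moves `y*` to the front, which leaves `u` alone on `Ω`, paired with a fixed vector.
  have e2 : ⟪Ω, (ι f * (x * u * star y)) Ω⟫_ℂ = ⟪star (ι f * x) (y Ω), u Ω⟫_ℂ := by
    have := hM.trace_comm (ι f * x * u) (mul_mem (mul_mem (hA.le (hX.mem f)) hx) (hA.le hu))
      (star y) (star_mem hy)
    rw [inner_star', ← inner_star y]
    simpa [mul_assoc] using this
  -- the function `s ↦ ∫ f(t) k(t, s)` represents the vector `x* f* y Ω`
  have e3 : (fun s => star (hX.toFun (star (ι f * x) (y Ω)) s)) =ᵐ[lam]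
      fun s => ∫ t, f t * k (t, s) ∂lam := by
    refine ae_eq_of_forall_integral_continuous_mul ?_ (hmul k hk).integral_prod_right fun g => ?_
    · exact (Complex.conjCLE : ℂ →L[ℝ] ℂ).integrable_comp (hX.integrable_toFun _)
    have h1 : ∫ s, g s * star (hX.toFun (star (ι f * x) (y Ω)) s) ∂lam
        = ⟪y Ω, (ι f * x * ι g) Ω⟫_ℂ := by
      have h2 := hX.inner_coord g (star (ι f * x) (y Ω))
      have h3 := congrArg star h2
      change _ = (starRingEnd ℂ) _ at h3
      rw [← integral_conj] at h3
      have h4 : star ⟪ι g Ω, star (ι f * x) (y Ω)⟫_ℂ = ⟪y Ω, (ι f * x * ι g) Ω⟫_ℂ := by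
        rw [inner_star]
        exact inner_conj_symm _ _
      rw [← h4, h3]
      simp
    rw [h1, hkxy]
    rw [integral_prod_symm _ ?_]
    · refine integral_congr_ae (ae_of_all _ fun s => ?_)
      simp only
      rw [← integral_const_mul]
      refine integral_congr_ae (ae_of_all _ fun t => ?_)
      simp only
      ring
    · have := (hmul k hk).bdd_mul (c := ‖g‖) (f := fun p : X × X => g p.2)
        (g.continuous.comp continuous_snd).aestronglyMeasurable
        (ae_of_all _ fun p => g.norm_coe_le_norm _)
      refine this.congr (ae_of_all _ fun p => ?_)
      simp only
      ring
  -- The kernel formula is given only for continuous `g`. Once the fixed vector is known as a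
  -- function, `inner_apply` allows any `u ∈ A`, and Fubini exchanges the integrals.
  rw [e1, e2, hX.inner_apply hu]
  have h5 := hmul _ hkψ
  have h6 : ∫ s, star (hX.toFun (star (ι f * x) (y Ω)) s) * hX.toFun (u Ω) s ∂lam
      = ∫ s, ∫ t, f t * (k (t, s) * hX.toFun (u Ω) s) ∂lam ∂lam := by
    refine integral_congr_ae ?_
    filter_upwards [e3] with s hs
    rw [hs, ← integral_mul_const]
    simp only [mul_assoc]
  have h7 := integral_prod_symm _ h5
  have h8 := integral_prod _ h5
  simp only at h7 h8
  rw [h6, ← h7, h8]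
  simp only [integral_const_mul]

end BimoduleDecomposition

/-! ### Almost everywhere convergence -/

theorem theorem4p3 {H : Type*} [NormedAddCommGroup H] [InnerProductSpace ℂ H] [CompleteSpace H]
    [TopologicalSpace.SeparableSpace H] {M A : VonNeumannAlgebra H} {Ω : H}
    (hM : IsIIOneStandardForm M Ω) (hA : IsMasa A M)
    {X : Type*} [TopologicalSpace X] [CompactSpace X] [T2Space X] [SecondCountableTopology X]
    [MeasurableSpace X] [BorelSpace X]
    (ι : C(X, ℂ) →⋆ₐ[ℂ] (H →L[ℂ] H)) (lam : Measure X) [IsProbabilityMeasure lam]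
    (hX : IsMasaCoordinates A Ω ι lam) (hprod : IsProductClass M Ω ι lam)
    (x y : H →L[ℂ] H) (hx : x ∈ M) (hy : y ∈ M)
    (hx0 : masaCondExp hM hA x hx = 0) (hy0 : masaCondExp hM hA y hy = 0)
    (u : ℕ → H →L[ℂ] H) (hu : ∀ n, u n ∈ A) (hbdd : ∃ C : ℝ, ∀ n, ‖u n‖ ≤ C)
    (hnull : Tendsto (fun n => ContinuousLinearMapWOT.ofCLM (u n)) atTop
      (𝓝 (0 : H →WOT[ℂ] H))) :
    (∀ n, ∃ φ : X → ℂ, IsFunctionOf Ω ι lam (masaCondExp hM hA (x * u n * star y)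
      (mul_mem (mul_mem hx (hA.le (hu n))) (star_mem hy))) φ) ∧
    ∀ φ : ℕ → X → ℂ, (∀ n, IsFunctionOf Ω ι lam (masaCondExp hM hA (x * u n * star y)
      (mul_mem (mul_mem hx (hA.le (hu n))) (star_mem hy))) (φ n)) →
      ∀ᵐ t ∂lam, Tendsto (fun n => φ n t) atTop (𝓝 0) := by
  have hmem : ∀ n, x * u n * star y ∈ M := fun n =>
    mul_mem (mul_mem hx (hA.le (hu n))) (star_mem hy)
  refine ⟨fun n => ⟨_, hX.isFunctionOf_toFun hA (masaCondExp_mem hM hA (hmem n))⟩,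
    fun φ hφ => ?_⟩
  obtain ⟨η, m, ⟨hη, -, -, W, hW⟩, hac, -⟩ := hprod
  have hx1 : ∀ c ∈ A, ⟪c Ω, x Ω⟫_ℂ = 0 := fun c hc => by
    have h1 := trace_mul_masaCondExp hM hA hx (star_mem hc)
    rw [hx0, mul_zero] at h1
    rw [← inner_star]
    simpa using h1.symm
  obtain ⟨k, hk, hkxy⟩ := exists_bimodule_density hM hA hX W hW hac hx hx1 (y Ω)
  obtain ⟨C, hC⟩ := hbdd
  -- Countably many null sets are merged, so that one set of full measure serves every `n`.
  have hφk : ∀ᵐ t ∂lam, ∀ n, φ n t = ∫ s, k (t, s) * hX.toFun (u n Ω) s ∂lam :=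
    ae_all_iff.2 fun n =>
      ((hφ n).ae_eq (hX.isFunctionOf_toFun hA (masaCondExp_mem hM hA (hmem n)))).trans
        (toFun_masaCondExp_ae_eq hM hA hX hx hy hk hkxy (hu n) (hmem n))
  -- Weak operator convergence, tested on `Ω` and `f* Ω`.
  have hnull' : ∀ f : C(X, ℂ),
      Tendsto (fun n => ∫ t, f t * hX.toFun (u n Ω) t ∂lam) atTop (𝓝 0) := by
    intro f
    have h1 := ((ContinuousLinearMapWOT.continuous_dual_apply Ω
      (innerSL ℂ (ι (star f) Ω))).tendsto (0 : H →WOT[ℂ] H)).comp hnull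
    have h2 : Tendsto (fun n => ⟪ι (star f) Ω, u n Ω⟫_ℂ) atTop (𝓝 0) := by
      convert h1 using 2
      · simp
      · exact (inner_zero_right (𝕜 := ℂ) (ι (star f) Ω)).symm
    refine h2.congr fun n => ?_
    rw [hX.inner_coord]
    simp
  -- For almost every `t` the section `k(t, ·)` is integrable, hence a legitimate test function for
  -- weak-* convergence.
  filter_upwards [hφk, hk.prod_right_ae] with t h1 h2
  simp only [h1]
  exact tendsto_integral_mul_of_forall_continuous (fun n => Lp.aestronglyMeasurable _)
    (fun n => (hX.norm_toFun_le hA (hu n)).mono fun s hs => hs.trans (hC n)) hnull' h2
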